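/- All algebras are complex. A Banach algebra $A$ is \emph{faithful} if, for $x\in A$, $Ax=\{0\}$ implies $x=0$ and $xA=\{0\}$ implies $x=0$. Its multiplier algebra $M(A)$ is the Banach algebra of pairs $\mu=(L,R)$ of bounded linear operators on $A$ with $R(a)b=aL(b)$ for all $a,b\in A$, with product $(L,R)(L',R')=(LL',R'R)$; for $a\in A$ write $\mu a=L(a)$ and $a\mu=R(a)$. A \emph{dual Banach algebra} is a Banach algebra $B$ together with a Banach space $X$ and a (not necessarily isometric) linear homeomorphism $B\cong X'$, such that the multiplication of $B$ is separately continuous for the resulting weak* topology $\sigma(B,X)$. The Banach algebra $A$ is \emph{compliant} if it is faithful and $M(A)$ is a dual Banach algebra, for some predual, in such a way that for every $a\in A$ the maps $M(A)\to A$, $\mu\mapsto\mu a$ and $\mu\mapsto a\mu$, are continuous from the weak* topology of $M(A)$ to the weak topology of $A$. The first Arens product $\Box$ on the bidual $A''$ is given by $\langle\Phi\,\Box\,\Psi,f\rangle=\langle\Phi,\Psi\cdot f\rangle$, where $\langle\Psi\cdot f,a\rangle=\langle\Psi,f\cdot a\rangle$ and $\langle f\cdot a,b\rangle=\langle f,ab\rangle$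 for $\Phi,\Psi\in A''$, $f\in A'$, $a,b\in A$. \textbf{Proposition.} (i) Let $A$ be a compliant Banach algebra. Then (the canonical image of) $A$ is a two-sided ideal in $(A'',\Box)$. (ii) Let $K$ be a locally compact Hausdorff space. The Banach algebra $C_0(K)$, with pointwise product and supremum norm, is compliant if and only if $K$ is discrete. (iii) Let $G$ be a locally compact Hausdorff group. The group algebra $L^1(G)$ of (classes of) functions integrable with respect to a left Haar measure, with the convolution product, is compliant if and only if $G$ is compact. -/

import Mathlib

open MeasureTheory Topology

universe u v w

set_option linter.unusedSectionVars false

noncomputable section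

/-! ### The group algebra of a locally compact group -/

/-- The space `L¹(G)` of (classes of) complex-valued integrable functions on `G`, as a type of its
own, so that it can carry the convolution product. -/
def GroupAlgebraL1 {G : Type u} [MeasurableSpace G] (μ : Measure G) : Type u :=
  Lp ℂ 1 μ

namespace GroupAlgebraL1

section Basic

variable {G : Type u} [MeasurableSpace G] (μ : Measure G)

instance instNormedAddCommGroup : NormedAddCommGroup (GroupAlgebraL1 μ) :=
  inferInstanceAs (NormedAddCommGroup (Lp ℂ 1 μ))

instance instNormedSpace : NormedSpace ℂ (GroupAlgebraL1 μ) :=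
  inferInstanceAs (NormedSpace ℂ (Lp ℂ 1 μ))

instance instCompleteSpace : CompleteSpace (GroupAlgebraL1 μ) :=
  inferInstanceAs (CompleteSpace (Lp ℂ 1 μ))

variable {μ}

/-- The underlying function (a representative of the class). -/
def toFun (f : GroupAlgebraL1 μ) : G → ℂ := (show Lp ℂ 1 μ from f : Lp ℂ 1 μ)

theorem integrable_toFun (f : GroupAlgebraL1 μ) : Integrable f.toFun μ :=
  L1.integrable_coeFn (show Lp ℂ 1 μ from f)

theorem norm_eq (f : GroupAlgebraL1 μ) : ‖f‖ = ∫ x, ‖f.toFun x‖ ∂μ :=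
  L1.norm_eq_integral_norm (show Lp ℂ 1 μ from f)

theorem add_ae (f g : GroupAlgebraL1 μ) :
    (f + g).toFun =ᵐ[μ] fun x => f.toFun x + g.toFun x :=
  Lp.coeFn_add (show Lp ℂ 1 μ from f) (show Lp ℂ 1 μ from g)

theorem smul_ae (c : ℂ) (f : GroupAlgebraL1 μ) :
    (c • f).toFun =ᵐ[μ] fun x => c * f.toFun x :=
  Lp.coeFn_smul c (show Lp ℂ 1 μ from f)

end Basic

section Translation

variable {G : Type u} [MeasurableSpace G] [Group G] [TopologicalSpace G] [IsTopologicalGroup G]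
  [BorelSpace G] (μ : Measure G) [μ.IsHaarMeasure]

/-- Left translation by `y` on `L¹(G)`: the isometry `f ↦ (x ↦ f (y⁻¹ * x))`. -/
def translate (y : G) : GroupAlgebraL1 μ →L[ℂ] GroupAlgebraL1 μ :=
  (Lp.compMeasurePreservingₗᵢ (E := ℂ) (p := 1) ℂ (fun x : G => y⁻¹ * x)
    (measurePreserving_mul_left μ y⁻¹)).toContinuousLinearMap

theorem norm_translate (y : G) (f : GroupAlgebraL1 μ) : ‖translate μ y f‖ = ‖f‖ :=
  LinearIsometry.norm_map (Lp.compMeasurePreservingₗᵢ (E := ℂ) (p := 1) ℂ (fun x : G => y⁻¹ * x)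
    (measurePreserving_mul_left μ y⁻¹)) f

theorem translate_ae (y : G) (f : GroupAlgebraL1 μ) :
    (translate μ y f).toFun =ᵐ[μ] fun x => f.toFun (y⁻¹ * x) :=
  Lp.coeFn_compMeasurePreserving (show Lp ℂ 1 μ from f) (measurePreserving_mul_left μ y⁻¹)

theorem translate_translate (y z : G) (f : GroupAlgebraL1 μ) :
    translate μ y (translate μ z f) = translate μ (y * z) f := by
  apply Lp.ext
  have h1 := translate_ae μ y (translate μ z f)
  have h2 := (measurePreserving_mul_left μ y⁻¹).quasiMeasurePreserving.ae_eq_comp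
    (translate_ae μ z f)
  have h3 := translate_ae μ (y * z) f
  refine h1.trans (h2.trans (Filter.EventuallyEq.trans ?_ h3.symm))
  exact Filter.Eventually.of_forall fun x => by simp [mul_assoc]

theorem continuous_translate [LocallyCompactSpace G] [μ.Regular] (f : GroupAlgebraL1 μ) :
    Continuous fun y => translate μ y f := by
  let g : C(G, C(G, G)) := (ContinuousMap.mk (fun a : G × G => a.1⁻¹ * a.2)
    (by fun_prop)).curry
  exact Continuous.compMeasurePreservingLp (f := fun _ : G => (show Lp ℂ 1 μ from f))
    continuous_const g.continuous (fun y => measurePreserving_mul_left μ y⁻¹)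
    ENNReal.one_ne_top

end Translation

section Convolution

variable {G : Type u} [MeasurableSpace G] [Group G] [TopologicalSpace G] [IsTopologicalGroup G]
  [LocallyCompactSpace G] [BorelSpace G] {μ : Measure G} [μ.IsHaarMeasure] [μ.Regular]

theorem integrable_smul_of_continuous {E : Type w} [NormedAddCommGroup E] [NormedSpace ℂ E]
    (f : GroupAlgebraL1 μ) {φ : G → E} (hφ : Continuous φ) (C : ℝ) (hC : ∀ x, ‖φ x‖ ≤ C) :
    Integrable (fun x => f.toFun x • φ x) μ := by
  have hf := f.integrable_toFun
  have hrestrict : ∀ s : Set G, MeasurableSet s → μ s ≠ ⊤ →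
      AEStronglyMeasurable φ (μ.restrict s) := by
    intro s hs hμs
    have hε : ∀ n : ℕ, ((n : ENNReal) + 1)⁻¹ ≠ 0 := fun n =>
      ENNReal.inv_ne_zero.2 (by finiteness)
    choose K hKs hKc hKcl hK using fun n : ℕ =>
      hs.exists_isCompact_isClosed_sdiff_lt hμs (hε n)
    have hlim : Filter.Tendsto (fun n : ℕ => ((n : ENNReal) + 1)⁻¹) Filter.atTop (nhds 0) := by
      simpa using (Filter.tendsto_add_atTop_iff_nat 1).2 ENNReal.tendsto_inv_nat_nhds_zero
    have hnull : μ (s \ ⋃ n, K n) = 0 := by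
      refine le_antisymm (ge_of_tendsto' hlim fun n => ?_) zero_le
      exact (measure_mono (Set.sdiff_subset_sdiff_right (Set.subset_iUnion K n))).trans (hK n).le
    have hU : AEStronglyMeasurable φ (μ.restrict (⋃ n, K n)) :=
      aestronglyMeasurable_iUnion_iff.2 fun n =>
        hφ.continuousOn.aestronglyMeasurable_of_isCompact (hKc n) (hKcl n).measurableSet
    have hsub : s ≤ᵐ[μ] (⋃ n, K n : Set G) := (ae_le_set).2 hnull
    exact hU.mono_measure (Measure.restrict_mono_ae hsub)
  have key : AEStronglyMeasurable (fun x => f.toFun x • φ x) μ := by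
    obtain ⟨g, ⟨F, hFfin, hFlim⟩, hfg⟩ := hf.aefinStronglyMeasurable
    refine AEStronglyMeasurable.congr (f := fun x => g x • φ x) ?_
      (by filter_upwards [hfg] with x hx; rw [hx])
    refine aestronglyMeasurable_of_tendsto_ae Filter.atTop
      (f := fun n x => F n x • (Function.support (F n)).indicator φ x) (fun n => ?_)
      (Filter.Eventually.of_forall fun x => ?_)
    · exact (F n).aestronglyMeasurable.smul
        ((aestronglyMeasurable_indicator_iff (F n).measurableSet_support).2
          (hrestrict _ (F n).measurableSet_support (hFfin n).ne))
    · refine ((hFlim x).smul_const (φ x)).congr fun n => ?_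
      by_cases h : F n x = 0
      · simp [h]
      · rw [Set.indicator_of_mem (Function.mem_support.2 h)]
  refine (hf.norm.mul_const C).mono' key (Filter.Eventually.of_forall fun x => ?_)
  rw [norm_smul]
  exact mul_le_mul_of_nonneg_left (hC x) (norm_nonneg _)

/-- The convolution product on `L¹(G)`, namely `f * g = ∫ f(y) L_y g dμ(y)`, an (absolutely
convergent) Bochner integral in `L¹(G)`, where `(L_y g)(x) = g(y⁻¹ x)`. -/
instance instMul : Mul (GroupAlgebraL1 μ) :=
  ⟨fun f g => ∫ y, f.toFun y • translate μ y g ∂μ⟩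

theorem mul_def (f g : GroupAlgebraL1 μ) : f * g = ∫ y, f.toFun y • translate μ y g ∂μ := rfl

theorem integrable_mul (f g : GroupAlgebraL1 μ) :
    Integrable (fun y => f.toFun y • translate μ y g) μ :=
  f.integrable_smul_of_continuous (continuous_translate μ g) ‖g‖ fun y =>
    (norm_translate μ y g).le

theorem norm_mul_le' (f g : GroupAlgebraL1 μ) : ‖f * g‖ ≤ ‖f‖ * ‖g‖ := by
  rw [mul_def, norm_eq f, ← integral_mul_const]
  refine (norm_integral_le_integral_norm _).trans (le_of_eq ?_)
  simp only [norm_smul, norm_translate]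

theorem mul_add' (f g h : GroupAlgebraL1 μ) : f * (g + h) = f * g + f * h := by
  simp only [mul_def, map_add, smul_add]
  exact integral_add (integrable_mul f g) (integrable_mul f h)

theorem add_mul' (f g h : GroupAlgebraL1 μ) : (f + g) * h = f * h + g * h := by
  rw [mul_def, mul_def, mul_def, ← integral_add (integrable_mul f h) (integrable_mul g h)]
  refine integral_congr_ae ?_
  filter_upwards [add_ae f g] with x hx
  rw [hx, add_smul]

theorem smul_mul' (c : ℂ) (f g : GroupAlgebraL1 μ) : (c • f) * g = c • (f * g) := by
  rw [mul_def, mul_def, ← integral_smul]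
  refine integral_congr_ae ?_
  filter_upwards [smul_ae c f] with x hx
  rw [hx, mul_smul]

theorem mul_smul' (c : ℂ) (f g : GroupAlgebraL1 μ) : f * (c • g) = c • (f * g) := by
  rw [mul_def, mul_def, ← integral_smul]
  simp only [map_smul, smul_comm c]

/-- Pairing a convolution product with a bounded continuous vector-valued function:
`∫ (f * g)(x) φ(x) dx = ∫ f(y) (∫ g(x) φ(y x) dx) dy`. -/
theorem integral_mul_smul {E : Type w} [NormedAddCommGroup E] [NormedSpace ℂ E] [CompleteSpace E]
    (f g : GroupAlgebraL1 μ) {φ : G → E} (hφ : Continuous φ) (C : ℝ) (hC : ∀ x, ‖φ x‖ ≤ C) :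
    ∫ x, (f * g).toFun x • φ x ∂μ =
      ∫ y, f.toFun y • ∫ x, g.toFun x • φ (y * x) ∂μ ∂μ := by
  let T : GroupAlgebraL1 μ →L[ℂ] E := LinearMap.mkContinuous
    { toFun := fun k => ∫ x, k.toFun x • φ x ∂μ
      map_add' := fun k l => by
        rw [← integral_add (k.integrable_smul_of_continuous hφ C hC)
          (l.integrable_smul_of_continuous hφ C hC)]
        refine integral_congr_ae ?_
        filter_upwards [add_ae k l] with x hx
        rw [hx, add_smul]
      map_smul' := fun c k => by
        rw [RingHom.id_apply, ← integral_smul]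
        refine integral_congr_ae ?_
        filter_upwards [smul_ae c k] with x hx
        rw [hx, mul_smul] } C (fun k => by
      change ‖∫ x, k.toFun x • φ x ∂μ‖ ≤ _
      rw [norm_eq k, ← integral_const_mul]
      refine norm_integral_le_of_norm_le (k.integrable_toFun.norm.const_mul C)
        (Filter.Eventually.of_forall fun x => ?_)
      rw [norm_smul, mul_comm]
      exact mul_le_mul_of_nonneg_right (hC x) (norm_nonneg _))
  have hT : ∀ k, T k = ∫ x, k.toFun x • φ x ∂μ := fun _ => rfl
  rw [← hT, mul_def, ← T.integral_comp_comm (integrable_mul f g)]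
  refine integral_congr_ae (Filter.Eventually.of_forall fun y => ?_)
  beta_reduce
  rw [map_smul, hT]
  congr 1
  have h1 : ∫ x, (translate μ y g).toFun x • φ x ∂μ = ∫ x, g.toFun (y⁻¹ * x) • φ x ∂μ := by
    refine integral_congr_ae ?_
    filter_upwards [translate_ae μ y g] with x hx
    rw [hx]
  rw [h1, ← integral_mul_left_eq_self (fun x => g.toFun (y⁻¹ * x) • φ x) y]
  simp

theorem mul_assoc' (f g h : GroupAlgebraL1 μ) : f * g * h = f * (g * h) := by
  rw [mul_def (f * g) h, integral_mul_smul f g (continuous_translate μ h) ‖h‖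
    fun y => (norm_translate μ y h).le, mul_def f (g * h)]
  refine integral_congr_ae (Filter.Eventually.of_forall fun y => ?_)
  simp only
  rw [mul_def g h, ← (translate μ y).integral_comp_comm (integrable_mul g h)]
  simp only [map_smul, translate_translate]

instance instNonUnitalNormedRing : NonUnitalNormedRing (GroupAlgebraL1 μ) :=
  { instNormedAddCommGroup μ, instMul with
    left_distrib := mul_add'
    right_distrib := add_mul'
    zero_mul := fun f => by simpa using smul_mul' (0 : ℂ) f f
    mul_zero := fun f => by simpa using mul_smul' (0 : ℂ) f f
    mul_assoc := mul_assoc'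
    norm_mul_le := norm_mul_le' }

instance instIsScalarTower : IsScalarTower ℂ (GroupAlgebraL1 μ) (GroupAlgebraL1 μ) :=
  ⟨fun c f g => smul_mul' c f g⟩

instance instSMulCommClass : SMulCommClass ℂ (GroupAlgebraL1 μ) (GroupAlgebraL1 μ) :=
  ⟨fun c f g => (mul_smul' c f g).symm⟩

end Convolution

end GroupAlgebraL1

/-! ### Dual Banach algebras and compliant Banach algebras -/

/-- Given an isomorphism `Φ` of a Banach space `B` with the dual of a Banach space `X`, the
weak* topology `σ(B, X)` on `B`. -/
@[reducible] def weakStarTopology {B : Type v} {X : Type w} [NormedAddCommGroup B] [NormedSpace ℂ B]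
    [NormedAddCommGroup X] [NormedSpace ℂ X] (Φ : B ≃L[ℂ] StrongDual ℂ X) : TopologicalSpace B :=
  TopologicalSpace.induced (fun b => StrongDual.toWeakDual (Φ b))
    (inferInstance : TopologicalSpace (WeakDual ℂ X))

/-- `B` is a dual Banach algebra with predual `X`, via the (not necessarily isometric)
isomorphism `Φ` of `B` with the dual of `X`: the multiplication of `B` is separately weak*
continuous. -/
def IsDualBanachAlgebra {B : Type v} {X : Type w} [NonUnitalNormedRing B] [NormedSpace ℂ B]
    [NormedAddCommGroup X] [NormedSpace ℂ X] (Φ : B ≃L[ℂ] StrongDual ℂ X) : Prop :=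
  ∀ b : B,
    Continuous[weakStarTopology Φ, weakStarTopology Φ] (fun x => b * x) ∧
    Continuous[weakStarTopology Φ, weakStarTopology Φ] (fun x => x * b)

/-- `A` is faithful: `A x = 0` implies `x = 0`, and `x A = 0` implies `x = 0`. -/
def IsFaithfulAlgebra (A : Type u) [NonUnitalNormedRing A] : Prop :=
  (∀ x : A, (∀ a : A, a * x = 0) → x = 0) ∧ (∀ x : A, (∀ a : A, x * a = 0) → x = 0)

/-- `A` is a compliant Banach algebra: it is faithful, and its multiplier algebra `M(A)`, the
algebra of pairs `μ = (L, R)` of bounded operators with `R(a) b = a L(b)`, is a dual Banach algebra,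
with some predual `X`, in such a way that for each `a` the maps `μ ↦ μ a = L(a)` and
`μ ↦ a μ = R(a)` are continuous from the weak* topology of `M(A)` to the weak topology of `A`. -/
def IsCompliant (A : Type u) [NonUnitalNormedRing A] [NormedSpace ℂ A] [IsScalarTower ℂ A A]
    [SMulCommClass ℂ A A] : Prop :=
  IsFaithfulAlgebra A ∧
  ∃ (X : Type u) (_ : NormedAddCommGroup X) (_ : NormedSpace ℂ X) (_ : CompleteSpace X)
    (Φ : DoubleCentralizer ℂ A ≃L[ℂ] StrongDual ℂ X),
    IsDualBanachAlgebra Φ ∧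
    ∀ a : A,
      Continuous[weakStarTopology Φ, inferInstance]
        (fun m : DoubleCentralizer ℂ A => toWeakSpace ℂ A (m.fst a)) ∧
      Continuous[weakStarTopology Φ, inferInstance]
        (fun m : DoubleCentralizer ℂ A => toWeakSpace ℂ A (m.snd a))

/-! ### The first Arens product -/

section Arens

variable {A : Type u} [NonUnitalNormedRing A] [NormedSpace ℂ A] [IsScalarTower ℂ A A]
  [SMulCommClass ℂ A A]

/-- The right action of `A` on its dual: `⟨f · a, b⟩ = ⟨f, a b⟩`. -/
def dualRightAction (f : StrongDual ℂ A) (a : A) : StrongDual ℂ A :=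
  f.comp (ContinuousLinearMap.mul ℂ A a)

/-- The left action of the bidual on the dual: `⟨Ψ · f, a⟩ = ⟨Ψ, f · a⟩`. -/
def bidualAction (Ψ : StrongDual ℂ (StrongDual ℂ A)) : StrongDual ℂ A →L[ℂ] StrongDual ℂ A :=
  LinearMap.mkContinuous₂
    { toFun := fun f =>
        { toFun := fun a => Ψ (dualRightAction f a)
          map_add' := fun a b => by
            rw [← map_add]; congr 1; ext c; simp [dualRightAction]
          map_smul' := fun c a => by
            rw [RingHom.id_apply, ← map_smul]; congr 1; ext b; simp [dualRightAction] }
      map_add' := fun f g => by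
        ext a
        change Ψ _ = Ψ _ + Ψ _
        rw [← map_add]; congr 1
      map_smul' := fun c f => by
        ext a
        change Ψ _ = c • Ψ _
        rw [← map_smul]; congr 1 }
    ‖Ψ‖ (fun f a => by
      change ‖Ψ (dualRightAction f a)‖ ≤ _
      rw [mul_assoc]
      refine (Ψ.le_opNorm _).trans (mul_le_mul_of_nonneg_left ?_ (norm_nonneg _))
      refine (ContinuousLinearMap.opNorm_comp_le _ _).trans
        (mul_le_mul_of_nonneg_left ?_ (norm_nonneg _))
      exact ContinuousLinearMap.opNorm_mul_apply_le ℂ A a)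

theorem bidualAction_apply (Ψ : StrongDual ℂ (StrongDual ℂ A)) (f : StrongDual ℂ A) (a : A) :
    bidualAction Ψ f a = Ψ (dualRightAction f a) := rfl

/-- The first Arens product on the bidual: `⟨Φ □ Ψ, f⟩ = ⟨Φ, Ψ · f⟩`. -/
def firstArensProduct (Φ Ψ : StrongDual ℂ (StrongDual ℂ A)) : StrongDual ℂ (StrongDual ℂ A) :=
  Φ.comp (bidualAction Ψ)

end Arens

/-- (The canonical image of) `A` is a two-sided ideal of its bidual with the first Arens
product. -/
def IsIdealInBidual (A : Type u) [NonUnitalNormedRing A] [NormedSpace ℂ A] [IsScalarTower ℂ A A]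
    [SMulCommClass ℂ A A] : Prop :=
  ∀ (a : A) (Ψ : StrongDual ℂ (StrongDual ℂ A)),
    firstArensProduct (NormedSpace.inclusionInDoubleDual ℂ A a) Ψ ∈
      Set.range (NormedSpace.inclusionInDoubleDual ℂ A) ∧
    firstArensProduct Ψ (NormedSpace.inclusionInDoubleDual ℂ A a) ∈
      Set.range (NormedSpace.inclusionInDoubleDual ℂ A)

end

/-! Being an ideal in the bidual means that all left and right multiplications have second adjoints
mapping `A''` into `A` (`isIdealInBidual_iff`), that is, they are weakly compact.

(i) The map `A → M(A) ≅ X'` transposes to `T : X → A'`. For `Ψ` in `A''`, the functional `Ψ ∘ T` is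
a multiplier `m`. Compliance makes `n ↦ f (n a)` and `n ↦ f (a n)` weak* continuous, hence
evaluations at vectors of `X`. Therefore `f (m a) = Ψ (a · f)` and `f (a m) = Ψ (f · a)`, so `m a`
and `a m` represent the two Arens products.

The positive halves of (ii) and (iii) use a converse, `IsIdealInBidual.isCompliant`: with a bounded
two-sided approximate identity, the closed span of `A · A'` and `A' · A` is a predual of `M(A)`. The
multiplications are shown to be norm limits of finite-rank operators. On discrete `K` this is
approximation by finitely supported functions; on compact `G` it is norm compactness of the orbit
`{L_y a}`, and inversion exchanges left and right.

For the negative halves, weak compactness is tested on one net. In `C₀(K)`, Urysohn functions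
shrinking to a point converge weakly to the indicator of that point, which must be continuous. In
`L¹(G)` with `G` noncompact, translates going to infinity keep their integral but leave every
compact set, so they have no weak cluster point of nonzero integral. -/

/-! ### Weakly compact multiplications -/

section Ideal

open Filter

variable {A : Type u} [NonUnitalNormedRing A] [NormedSpace ℂ A] [IsScalarTower ℂ A A]
  [SMulCommClass ℂ A A]

/-- The left action of `A` on its dual: `⟨a · f, b⟩ = ⟨f, b a⟩`. -/
noncomputable def dualLeftAction (a : A) (f : StrongDual ℂ A) : StrongDual ℂ A :=
  f.comp ((ContinuousLinearMap.mul ℂ A).flip a)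

@[simp] theorem dualLeftAction_apply (a b : A) (f : StrongDual ℂ A) :
    dualLeftAction a f b = f (b * a) := rfl

@[simp] theorem dualRightAction_apply (a b : A) (f : StrongDual ℂ A) :
    dualRightAction f a b = f (a * b) := rfl

theorem isIdealInBidual_iff : IsIdealInBidual A ↔
    ∀ (a : A) (Ψ : StrongDual ℂ (StrongDual ℂ A)),
      (∃ g : A, ∀ f : StrongDual ℂ A, f g = Ψ (dualRightAction f a)) ∧
      (∃ g : A, ∀ f : StrongDual ℂ A, f g = Ψ (dualLeftAction a f)) := by
  refine forall_congr' fun a => forall_congr' fun Ψ => and_congr ?_ ?_ <;>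
  · simp only [Set.mem_range, ContinuousLinearMap.ext_iff]
    rfl

/-- A weak* continuous functional is the evaluation at a vector of the predual. -/
theorem exists_predual_vector {B : Type v} {X : Type w} [NormedAddCommGroup B] [NormedSpace ℂ B]
    [NormedAddCommGroup X] [NormedSpace ℂ X] (Φ : B ≃L[ℂ] StrongDual ℂ X) (φ : B →ₗ[ℂ] ℂ)
    (hφ : Continuous[weakStarTopology Φ, inferInstance] φ) : ∃ x : X, ∀ b, φ b = Φ b x := by
  -- `φ` is moved to the weak* dual of `X`, where continuous functionals are evaluations.
  let e : WeakBilin (topDualPairing ℂ X) →ₗ[ℂ] B :=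
    Φ.symm.toLinearEquiv.toLinearMap ∘ₗ (WeakDual.toStrongDual (𝕜 := ℂ) (E := X)).toLinearMap
  have he : Continuous[inferInstance, weakStarTopology Φ] e := by
    rw [continuous_induced_rng]
    convert! continuous_id (X := WeakDual ℂ X) using 1
    ext y : 1
    exact Φ.apply_symm_apply (WeakDual.toStrongDual y)
  obtain ⟨x, hx⟩ := LinearMap.dualEmbedding_surjective (topDualPairing ℂ X)
    ⟨φ ∘ₗ e, @Continuous.comp _ _ _ _ (weakStarTopology Φ) _ _ _ hφ he⟩
  refine ⟨x, fun b => ?_⟩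
  have := congrArg (fun l => l (StrongDual.toWeakDual (Φ b))) hx
  have h2 : e (StrongDual.toWeakDual (Φ b)) = b := Φ.symm_apply_apply b
  exact (congrArg φ h2).symm.trans this.symm

theorem norm_doubleCentralizer_coe_le (a : A) : ‖(a : DoubleCentralizer ℂ A)‖ ≤ ‖a‖ := by
  rw [DoubleCentralizer.norm_def]
  refine max_le ?_ ?_
  · exact ContinuousLinearMap.opNorm_mul_apply_le ℂ A a
  · exact ContinuousLinearMap.opNorm_le_bound _ (norm_nonneg _) fun b =>
      (norm_mul_le b a).trans_eq (mul_comm _ _)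

/-- The canonical homomorphism of `A` into its multiplier algebra. -/
noncomputable def toMultiplier (A : Type u) [NonUnitalNormedRing A] [NormedSpace ℂ A]
    [IsScalarTower ℂ A A] [SMulCommClass ℂ A A] : A →L[ℂ] DoubleCentralizer ℂ A :=
  LinearMap.mkContinuous
    { toFun := fun a => (a : DoubleCentralizer ℂ A)
      map_add' := fun a b => by
        ext c <;> simp
      map_smul' := fun c a => by
        ext b <;> simp } 1 (fun a => by
      simpa using! norm_doubleCentralizer_coe_le a)

@[simp] theorem toMultiplier_fst (a b : A) : (toMultiplier A a).fst b = a * b := rfl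

@[simp] theorem toMultiplier_snd (a b : A) : (toMultiplier A a).snd b = b * a := rfl

theorem continuous_apply_weakSpace {E : Type v} [NormedAddCommGroup E] [NormedSpace ℂ E]
    (f : StrongDual ℂ E) : Continuous fun x : WeakSpace ℂ E => f ((toWeakSpace ℂ E).symm x) :=
  WeakBilin.eval_continuous (topDualPairing ℂ E).flip f

/-- A compliant Banach algebra is a two-sided ideal in its bidual. -/
theorem IsCompliant.isIdealInBidual (h : IsCompliant A) : IsIdealInBidual A := by
  obtain ⟨-, X, _, _, _, Φ, -, hc⟩ := h
  rw [isIdealInBidual_iff]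
  intro a Ψ
  -- `T x` is the restriction to `A` of evaluation at `x`; `m` is then the value at `Ψ` of the weak*
  -- extension of `A → M(A)` to `A''`.
  let T : X →L[ℂ] StrongDual ℂ A :=
    ((Φ : DoubleCentralizer ℂ A →L[ℂ] StrongDual ℂ X).comp (toMultiplier A)).flip
  let m : DoubleCentralizer ℂ A := Φ.symm (Ψ.comp T)
  have hm : ∀ x, Φ m x = Ψ (T x) := fun x => by simp [m]
  have key : ∀ φ : DoubleCentralizer ℂ A →ₗ[ℂ] ℂ,
      Continuous[weakStarTopology Φ, inferInstance] φ → ∀ f : StrongDual ℂ A,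
      (∀ b, φ (toMultiplier A b) = f b) → φ m = Ψ f := by
    intro φ hφ f hf
    obtain ⟨x, hx⟩ := exists_predual_vector Φ φ hφ
    rw [hx, hm]
    congr 1
    ext b
    rw [← hf, hx]
    rfl
  constructor
  · refine ⟨m.snd a, fun f => ?_⟩
    refine key { toFun := fun m => f (m.snd a), map_add' := by simp, map_smul' := by simp } ?_ _ ?_
    · exact @Continuous.comp _ _ _ (weakStarTopology Φ) _ _
        (fun m : DoubleCentralizer ℂ A => toWeakSpace ℂ A (m.snd a)) _
        (continuous_apply_weakSpace f) (hc a).2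
    · intro b
      rfl
  · refine ⟨m.fst a, fun f => ?_⟩
    refine key { toFun := fun m => f (m.fst a), map_add' := by simp, map_smul' := by simp } ?_ _ ?_
    · exact @Continuous.comp _ _ _ (weakStarTopology Φ) _ _
        (fun m : DoubleCentralizer ℂ A => toWeakSpace ℂ A (m.fst a)) _
        (continuous_apply_weakSpace f) (hc a).1
    · intro b
      rfl

/-! ### Weak limits and second adjoints -/

/-- The limit along an ultrafilter of the functionals `f ↦ f (h i)`, for a bounded family `h`. -/
theorem exists_bidual_limit {E : Type v} [NormedAddCommGroup E] [NormedSpace ℂ E] {ι : Type w}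
    (U : Ultrafilter ι) (h : ι → E) (C : ℝ) (hC : ∀ i, ‖h i‖ ≤ C) :
    ∃ Ψ : StrongDual ℂ (StrongDual ℂ E), ∀ f, Tendsto (fun i => f (h i)) U (𝓝 (Ψ f)) := by
  let J : ι → WeakDual ℂ (StrongDual ℂ E) := fun i =>
    StrongDual.toWeakDual (NormedSpace.inclusionInDoubleDual ℂ E (h i))
  have hK := WeakDual.isCompact_closedBall (𝕜 := ℂ) (0 : StrongDual ℂ (StrongDual ℂ E)) C
  obtain ⟨Ψ, -, hΨ⟩ := hK.ultrafilter_le_nhds (U.map J) (by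
    rw [le_principal_iff]
    refine Eventually.of_forall (f := (U : Filter ι)) fun i => ?_
    simpa [J] using (NormedSpace.double_dual_bound ℂ E (h i)).trans (hC i))
  refine ⟨WeakDual.toStrongDual Ψ, fun f => ?_⟩
  exact ((WeakBilin.eval_continuous (topDualPairing ℂ (StrongDual ℂ E)) f).tendsto Ψ).comp hΨ

/-- In an algebra which is an ideal in its bidual, multiplications are weakly compact. -/
theorem IsIdealInBidual.exists_weak_limit_mul (hA : IsIdealInBidual A) {ι : Type w}
    (U : Ultrafilter ι) (h : ι → A) (C : ℝ) (hC : ∀ i, ‖h i‖ ≤ C) (a : A) :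
    ∃ g : A, ∀ f : StrongDual ℂ A, Tendsto (fun i => f (h i * a)) U (𝓝 (f g)) := by
  obtain ⟨Ψ, hΨ⟩ := exists_bidual_limit U h C hC
  obtain ⟨g, hg⟩ := (isIdealInBidual_iff.1 hA a Ψ).2
  refine ⟨g, fun f => ?_⟩
  rw [hg]
  exact hΨ (dualLeftAction a f)

/-- The operators `T` on `E` whose second adjoint maps the bidual into `E`. -/
def biadjointIntoSelf (E : Type v) [NormedAddCommGroup E] [NormedSpace ℂ E] [CompleteSpace E]
    (Ψ : StrongDual ℂ (StrongDual ℂ E)) : Submodule ℂ (E →L[ℂ] E) where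
  carrier := {T | ∃ g : E, ∀ f : StrongDual ℂ E, f g = Ψ (f.comp T)}
  add_mem' := by
    rintro S T ⟨g, hg⟩ ⟨k, hk⟩
    exact ⟨g + k, fun f => by rw [map_add, hg, hk, ContinuousLinearMap.comp_add, map_add]⟩
  zero_mem' := ⟨0, fun f => by simp⟩
  smul_mem' := by
    rintro c T ⟨g, hg⟩
    exact ⟨c • g, fun f => by rw [map_smul, hg, ContinuousLinearMap.comp_smul, map_smul]⟩

theorem mem_biadjointIntoSelf {E : Type v} [NormedAddCommGroup E] [NormedSpace ℂ E]
    [CompleteSpace E] {Ψ : StrongDual ℂ (StrongDual ℂ E)} {T : E →L[ℂ] E} :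
    T ∈ biadjointIntoSelf E Ψ ↔ ∃ g : E, ∀ f : StrongDual ℂ E, f g = Ψ (f.comp T) := Iff.rfl

/-- The set is the preimage of the canonical copy of `E`, complete and hence closed in `E''`, under
the bounded map `T ↦ T'' Ψ`. Together with the rank-one case below, this covers norm limits of
finite-rank operators. -/
theorem isClosed_biadjointIntoSelf {E : Type v} [NormedAddCommGroup E] [NormedSpace ℂ E]
    [CompleteSpace E] (Ψ : StrongDual ℂ (StrongDual ℂ E)) :
    IsClosed (biadjointIntoSelf E Ψ : Set (E →L[ℂ] E)) := by
  let P : (E →L[ℂ] E) →L[ℂ] StrongDual ℂ (StrongDual ℂ E) :=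
    LinearMap.mkContinuous₂
      { toFun := fun T =>
          { toFun := fun f => Ψ (f.comp T)
            map_add' := fun f g => by rw [ContinuousLinearMap.add_comp, map_add]
            map_smul' := fun c f => by rw [ContinuousLinearMap.smul_comp, map_smul]; rfl }
        map_add' := fun S T => by
          ext f
          change Ψ _ = Ψ _ + Ψ _
          rw [ContinuousLinearMap.comp_add, map_add]
        map_smul' := fun c T => by
          ext f
          change Ψ _ = c • Ψ _
          rw [ContinuousLinearMap.comp_smul, map_smul] } ‖Ψ‖ (fun T f => by
        change ‖Ψ (f.comp T)‖ ≤ _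
        refine (Ψ.le_opNorm _).trans ?_
        rw [mul_assoc, mul_comm ‖T‖]
        exact mul_le_mul_of_nonneg_left (ContinuousLinearMap.opNorm_comp_le _ _) (norm_nonneg _))
  have hr : IsClosed (Set.range (NormedSpace.inclusionInDoubleDualLi (E := E) ℂ)) :=
    (NormedSpace.inclusionInDoubleDualLi (E := E) ℂ).isometry.isUniformInducing.isComplete_range.isClosed
  convert hr.preimage P.continuous using 1
  ext T
  simp only [SetLike.mem_coe, mem_biadjointIntoSelf, Set.mem_preimage, Set.mem_range,
    ContinuousLinearMap.ext_iff]
  rfl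

theorem smulRight_mem_biadjointIntoSelf {E : Type v} [NormedAddCommGroup E] [NormedSpace ℂ E]
    [CompleteSpace E] (Ψ : StrongDual ℂ (StrongDual ℂ E)) (l : StrongDual ℂ E) (v : E) :
    l.smulRight v ∈ biadjointIntoSelf E Ψ := by
  refine ⟨Ψ l • v, fun f => ?_⟩
  have : f.comp (l.smulRight v) = f v • l := by
    ext x
    simp [mul_comm]
  rw [this]
  simp [mul_comm]

end Ideal

/-! ### Ideals in the bidual with a bounded approximate identity are compliant -/

section Predual

open Filter

variable {A : Type u} [NonUnitalNormedRing A] [NormedSpace ℂ A] [IsScalarTower ℂ A A]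
  [SMulCommClass ℂ A A]

theorem isFaithfulAlgebra_of_tendsto {ι : Type w} (l : Filter ι) [l.NeBot] (e : ι → A)
    (hl : ∀ a, Tendsto (fun i => e i * a) l (𝓝 a)) (hr : ∀ a, Tendsto (fun i => a * e i) l (𝓝 a)) :
    IsFaithfulAlgebra A :=
  ⟨fun x hx => (tendsto_nhds_unique (f := fun _ => 0) (l := l) (by simpa [hx] using hl x)
    tendsto_const_nhds),
    fun x hx => (tendsto_nhds_unique (f := fun _ => 0) (l := l) (by simpa [hx] using hr x)
    tendsto_const_nhds)⟩

/-- Multiplying on the left by any `c` turns both sides into `R(c) a b`; faithfulness cancels `c`.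
-/
theorem IsFaithfulAlgebra.fst_mul (hA : IsFaithfulAlgebra A) (m : DoubleCentralizer ℂ A)
    (a b : A) : m.fst (a * b) = m.fst a * b := by
  refine sub_eq_zero.1 (hA.1 _ fun c => ?_)
  rw [mul_sub, ← mul_assoc, ← m.central, ← m.central, mul_assoc, sub_self]

theorem IsFaithfulAlgebra.snd_mul (hA : IsFaithfulAlgebra A) (m : DoubleCentralizer ℂ A)
    (a b : A) : m.snd (a * b) = a * m.snd b := by
  refine sub_eq_zero.1 (hA.2 _ fun c => ?_)
  rw [sub_mul, m.central, mul_assoc, mul_assoc, m.central, sub_self]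

/-- The closed linear span of the functionals `a · f` and `f · a` in the dual of `A`. -/
noncomputable def multiplierPredual (A : Type u) [NonUnitalNormedRing A] [NormedSpace ℂ A]
    [IsScalarTower ℂ A A] [SMulCommClass ℂ A A] : Submodule ℂ (StrongDual ℂ A) :=
  (Submodule.span ℂ (Set.range (fun p : A × StrongDual ℂ A => dualLeftAction p.1 p.2) ∪
    Set.range (fun p : A × StrongDual ℂ A => dualRightAction p.2 p.1))).topologicalClosure

theorem dualLeftAction_mem_multiplierPredual (a : A) (f : StrongDual ℂ A) :
    dualLeftAction a f ∈ multiplierPredual A :=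
  Submodule.le_topologicalClosure _ (Submodule.subset_span (Or.inl ⟨(a, f), rfl⟩))

theorem dualRightAction_mem_multiplierPredual (a : A) (f : StrongDual ℂ A) :
    dualRightAction f a ∈ multiplierPredual A :=
  Submodule.le_topologicalClosure _ (Submodule.subset_span (Or.inr ⟨(a, f), rfl⟩))

theorem multiplierPredual_le {S : Submodule ℂ (StrongDual ℂ A)}
    (hS : IsClosed (S : Set (StrongDual ℂ A))) (hl : ∀ a f, dualLeftAction a f ∈ S)
    (hr : ∀ a f, dualRightAction f a ∈ S) : multiplierPredual A ≤ S := by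
  refine Submodule.topologicalClosure_minimal _ (Submodule.span_le.2 ?_) hS
  rintro _ (⟨p, rfl⟩ | ⟨p, rfl⟩)
  · exact hl _ _
  · exact hr _ _

theorem eqOn_multiplierPredual {F G : StrongDual ℂ (StrongDual ℂ A)}
    (hl : ∀ a f, F (dualLeftAction a f) = G (dualLeftAction a f))
    (hr : ∀ a f, F (dualRightAction f a) = G (dualRightAction f a)) :
    ∀ x ∈ multiplierPredual A, F x = G x := by
  intro x hx
  have := multiplierPredual_le (S := LinearMap.ker ((F - G : StrongDual ℂ (StrongDual ℂ A)) :
    StrongDual ℂ A →ₗ[ℂ] ℂ)) (F - G).isClosed_ker (fun a f => by simp [hl])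
    (fun a f => by simp [hr]) hx
  simpa [sub_eq_zero] using this

/-- Precomposition of functionals with an operator. -/
noncomputable def precompDual (T : A →L[ℂ] A) : StrongDual ℂ A →L[ℂ] StrongDual ℂ A :=
  (ContinuousLinearMap.compL ℂ A A ℂ).flip T

@[simp] theorem precompDual_apply (T : A →L[ℂ] A) (f : StrongDual ℂ A) :
    precompDual T f = f.comp T := rfl

/-- This and the next three formulas show that `M(A)` maps the generators of the predual to
generators, so that the predual is stable under both actions. -/
theorem IsFaithfulAlgebra.dualLeftAction_comp_fst (hA : IsFaithfulAlgebra A)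
    (m : DoubleCentralizer ℂ A) (a : A) (f : StrongDual ℂ A) :
    (dualLeftAction a f).comp m.fst = dualLeftAction a (f.comp m.fst) := by
  ext b
  simp [hA.fst_mul]

theorem dualRightAction_comp_fst (m : DoubleCentralizer ℂ A) (a : A) (f : StrongDual ℂ A) :
    (dualRightAction f a).comp m.fst = dualRightAction f (m.snd a) := by
  ext b
  simp [m.central]

theorem dualLeftAction_comp_snd (m : DoubleCentralizer ℂ A) (a : A) (f : StrongDual ℂ A) :
    (dualLeftAction a f).comp m.snd = dualLeftAction (m.fst a) f := by
  ext b
  simp [m.central]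

theorem IsFaithfulAlgebra.dualRightAction_comp_snd (hA : IsFaithfulAlgebra A)
    (m : DoubleCentralizer ℂ A) (a : A) (f : StrongDual ℂ A) :
    (dualRightAction f a).comp m.snd = dualRightAction (f.comp m.snd) a := by
  ext b
  simp [hA.snd_mul]

theorem IsFaithfulAlgebra.comp_fst_mem (hA : IsFaithfulAlgebra A) (m : DoubleCentralizer ℂ A)
    {x : StrongDual ℂ A} (hx : x ∈ multiplierPredual A) : x.comp m.fst ∈ multiplierPredual A := by
  refine multiplierPredual_le (S := (multiplierPredual A).comap
    (precompDual m.fst : StrongDual ℂ A →ₗ[ℂ] StrongDual ℂ A)) ?_ ?_ ?_ hx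
  · exact (Submodule.isClosed_topologicalClosure _).preimage (precompDual m.fst).continuous
  · intro a f
    simpa [hA.dualLeftAction_comp_fst] using dualLeftAction_mem_multiplierPredual _ _
  · intro a f
    simpa [dualRightAction_comp_fst] using dualRightAction_mem_multiplierPredual _ _

theorem IsFaithfulAlgebra.comp_snd_mem (hA : IsFaithfulAlgebra A) (m : DoubleCentralizer ℂ A)
    {x : StrongDual ℂ A} (hx : x ∈ multiplierPredual A) : x.comp m.snd ∈ multiplierPredual A := by
  refine multiplierPredual_le (S := (multiplierPredual A).comap
    (precompDual m.snd : StrongDual ℂ A →ₗ[ℂ] StrongDual ℂ A)) ?_ ?_ ?_ hx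
  · exact (Submodule.isClosed_topologicalClosure _).preimage (precompDual m.snd).continuous
  · intro a f
    simpa [dualLeftAction_comp_snd] using dualLeftAction_mem_multiplierPredual _ _
  · intro a f
    simpa [hA.dualRightAction_comp_snd] using dualRightAction_mem_multiplierPredual _ _

/-- The pairing of multipliers with functionals determined by a functional `E` on the dual. -/
noncomputable def multiplierPairing {X : Type v} [NormedAddCommGroup X] [NormedSpace ℂ X]
    (J : X →L[ℂ] StrongDual ℂ A) (E : StrongDual ℂ (StrongDual ℂ A)) :
    DoubleCentralizer ℂ A →L[ℂ] StrongDual ℂ X :=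
  LinearMap.mkContinuous₂
    { toFun := fun m => ((E.comp (precompDual m.fst)).comp J : X →ₗ[ℂ] ℂ)
      map_add' := fun m n => by
        ext x
        simp
      map_smul' := fun c m => by
        ext x
        simp } (‖E‖ * ‖J‖) (fun m x => by
      refine (E.le_opNorm _).trans ?_
      rw [mul_assoc, mul_assoc, mul_comm ‖m‖, ← mul_assoc ‖J‖]
      refine mul_le_mul_of_nonneg_left ((ContinuousLinearMap.opNorm_comp_le _ _).trans ?_)
        (norm_nonneg _)
      refine mul_le_mul (J.le_opNorm x) ?_ (norm_nonneg _) (by positivity)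
      exact (le_max_left _ _).trans_eq (DoubleCentralizer.norm_def m).symm)

/-- The vector chosen for each `a` is unique since functionals separate points, so it depends
linearly on `a`, with norm at most `‖Ψ‖ ‖B‖ ‖a‖`. -/
theorem exists_clm_of_biadjoint {E : Type w} [NormedAddCommGroup E] [NormedSpace ℂ E]
    {F : Type v} [NormedAddCommGroup F] [NormedSpace ℂ F]
    (Ψ : StrongDual ℂ (StrongDual ℂ E)) (B : F →L[ℂ] E →L[ℂ] E)
    (h : ∀ a, ∃ g : E, ∀ f : StrongDual ℂ E, f g = Ψ (f.comp (B a))) :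
    ∃ L : F →L[ℂ] E, ∀ a, ∀ f : StrongDual ℂ E, f (L a) = Ψ (f.comp (B a)) := by
  choose g hg using h
  refine ⟨LinearMap.mkContinuous
    { toFun := g
      map_add' := fun a b => SeparatingDual.eq_iff_forall_dual_eq.2 fun f : StrongDual ℂ E => by
        rw [map_add, hg, hg, hg, map_add, ContinuousLinearMap.comp_add, map_add]
      map_smul' := fun c a => SeparatingDual.eq_iff_forall_dual_eq.2 fun f : StrongDual ℂ E => by
        rw [map_smul, hg, hg, map_smul, ContinuousLinearMap.comp_smul, map_smul]
        rfl }
    (‖Ψ‖ * ‖B‖) (fun a => NormedSpace.norm_le_dual_bound ℂ _ (by positivity) fun f => ?_), hg⟩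
  rw [LinearMap.coe_mk, AddHom.coe_mk, hg]
  refine (Ψ.le_opNorm _).trans ?_
  rw [mul_assoc, mul_assoc, ← mul_assoc ‖B‖, mul_comm _ ‖f‖]
  gcongr
  refine (ContinuousLinearMap.opNorm_comp_le _ _).trans ?_
  gcongr
  exact B.le_opNorm a

/-- A closed subspace, as a Banach space isometrically embedded in the ambient space. -/
theorem exists_linearIsometry_range_eq {F : Type u} [NormedAddCommGroup F] [NormedSpace ℂ F]
    [CompleteSpace F] (S : Submodule ℂ F) (hS : IsClosed (S : Set F)) :
    ∃ (X : Type u) (_ : NormedAddCommGroup X) (_ : NormedSpace ℂ X) (_ : CompleteSpace X)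
      (J : X →L[ℂ] F), (∀ x, J x ∈ S) ∧ (∀ y ∈ S, ∃ x, J x = y) ∧
      ∀ φ : StrongDual ℂ X, ∃ Ψ : StrongDual ℂ F, ∀ x, Ψ (J x) = φ x :=
  ⟨S, inferInstance, inferInstance, hS.completeSpace_coe, S.subtypeL, fun x => x.2,
    fun y hy => ⟨⟨y, hy⟩, rfl⟩, fun φ => (exists_extension_norm_eq S φ).imp fun _ h => h.1⟩

/-- Every functional on the dual of an ideal in its bidual acts as a multiplier. -/
theorem IsIdealInBidual.exists_multiplier (hA : IsIdealInBidual A)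
    (Ψ : StrongDual ℂ (StrongDual ℂ A)) : ∃ m : DoubleCentralizer ℂ A, ∀ a f,
      f (m.fst a) = Ψ (dualLeftAction a f) ∧ f (m.snd a) = Ψ (dualRightAction f a) := by
  rw [isIdealInBidual_iff] at hA
  obtain ⟨L, hL⟩ := exists_clm_of_biadjoint Ψ (ContinuousLinearMap.mul ℂ A).flip
    fun a => (hA a Ψ).2
  obtain ⟨R, hR⟩ := exists_clm_of_biadjoint Ψ (ContinuousLinearMap.mul ℂ A)
    fun a => (hA a Ψ).1
  refine ⟨⟨(L, R), fun a b => SeparatingDual.eq_iff_forall_dual_eq.2 fun f : StrongDual ℂ A => ?_⟩,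
    fun a f => ⟨hL a f, hR a f⟩⟩
  -- Tested on `f`, both `R(a) b` and `a L(b)` give the value of `Ψ` at `c ↦ f (a c b)`.
  have h1 := hR a (dualLeftAction b f)
  have h2 := hL b (dualRightAction f a)
  refine h1.trans (Eq.trans ?_ h2.symm)
  change Ψ _ = Ψ _
  congr 1
  ext c
  simp [mul_assoc]

theorem continuous_weakStar_apply {B : Type v} {X : Type w} [NormedAddCommGroup B]
    [NormedSpace ℂ B] [NormedAddCommGroup X] [NormedSpace ℂ X] (Φ : B ≃L[ℂ] StrongDual ℂ X)
    (x : X) : Continuous[weakStarTopology Φ, inferInstance] fun b => Φ b x :=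
  @Continuous.comp _ _ _ (weakStarTopology Φ) _ _ (fun b => StrongDual.toWeakDual (Φ b)) _
    (WeakBilin.eval_continuous (topDualPairing ℂ X) x) continuous_induced_dom

theorem continuous_toWeakDual {α : Type*} [TopologicalSpace α] {X : Type w} [NormedAddCommGroup X]
    [NormedSpace ℂ X] {g : α → StrongDual ℂ X} (hg : ∀ x, Continuous fun a => g a x) :
    Continuous fun a => StrongDual.toWeakDual (g a) :=
  WeakBilin.continuous_of_continuous_eval _ hg

theorem continuous_toWeakSpace {α : Type*} [TopologicalSpace α] {X : Type w} [NormedAddCommGroup X]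
    [NormedSpace ℂ X] {g : α → X} (hg : ∀ f : StrongDual ℂ X, Continuous fun a => f (g a)) :
    Continuous fun a => toWeakSpace ℂ X (g a) :=
  WeakBilin.continuous_of_continuous_eval _ hg

/-- An ideal in its bidual which has a bounded approximate identity is compliant. -/
theorem IsIdealInBidual.isCompliant [CompleteSpace A] (hA : IsIdealInBidual A) {ι : Type w}
    (l : Filter ι) [l.NeBot] (e : ι → A) (C : ℝ) (hC : ∀ i, ‖e i‖ ≤ C)
    (hl : ∀ a, Tendsto (fun i => e i * a) l (𝓝 a))
    (hr : ∀ a, Tendsto (fun i => a * e i) l (𝓝 a)) : IsCompliant A := by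
  have hF := isFaithfulAlgebra_of_tendsto l e hl hr
  -- `E`, a weak* cluster point of the approximate identity, is a unit for both actions. The pairing
  -- `⟨m, x⟩ = E (x ∘ L)` then gives `f (m a)` at `a · f` and `f (a m)` at `f · a`, which determine
  -- `m`.
  obtain ⟨E, hE⟩ := exists_bidual_limit (Ultrafilter.of l) e C hC
  have hEl : ∀ a f, E (dualLeftAction a f) = f a := fun a f =>
    tendsto_nhds_unique (hE _)
      ((f.continuous.tendsto _).comp ((hl a).mono_left (Ultrafilter.of_le l)))
  have hEr : ∀ a f, E (dualRightAction f a) = f a := fun a f =>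
    tendsto_nhds_unique (hE _)
      ((f.continuous.tendsto _).comp ((hr a).mono_left (Ultrafilter.of_le l)))
  have hEl' : ∀ (m : DoubleCentralizer ℂ A) a f,
      E ((dualLeftAction a f).comp m.fst) = f (m.fst a) := fun m a f => by
    rw [hF.dualLeftAction_comp_fst, hEl]; rfl
  have hEr' : ∀ (m : DoubleCentralizer ℂ A) a f,
      E ((dualRightAction f a).comp m.fst) = f (m.snd a) := fun m a f => by
    rw [dualRightAction_comp_fst, hEr]
  obtain ⟨X, _, _, _, J, hJmem, hJ, hJext⟩ := exists_linearIsometry_range_eq (multiplierPredual A)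
    (Submodule.isClosed_topologicalClosure _)
  have hinj : LinearMap.ker (multiplierPairing J E : DoubleCentralizer ℂ A →ₗ[ℂ] StrongDual ℂ X) = ⊥ := by
    rw [LinearMap.ker_eq_bot']
    intro m hm
    have h0 : ∀ y ∈ multiplierPredual A, E (y.comp m.fst) = 0 := fun y hy => by
      obtain ⟨x, rfl⟩ := hJ y hy
      exact congrArg (fun φ : StrongDual ℂ X => φ x) hm
    ext a
    · refine SeparatingDual.eq_iff_forall_dual_eq.2 fun f : StrongDual ℂ A => ?_
      rw [← hEl' m a f]
      simpa using h0 _ (dualLeftAction_mem_multiplierPredual a f)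
    · refine SeparatingDual.eq_iff_forall_dual_eq.2 fun f : StrongDual ℂ A => ?_
      rw [← hEr' m a f]
      simpa using h0 _ (dualRightAction_mem_multiplierPredual a f)
  have hsurj : LinearMap.range (multiplierPairing J E : DoubleCentralizer ℂ A →ₗ[ℂ] StrongDual ℂ X) = ⊤ := by
    rw [LinearMap.range_eq_top]
    intro φ
    -- `Ψ` is a Hahn–Banach extension of `φ` to `A'`; the ideal property turns it into a multiplier.
    obtain ⟨Ψ, hΨ⟩ := hJext φ
    obtain ⟨m, hm⟩ := hA.exists_multiplier Ψ
    refine ⟨m, ContinuousLinearMap.ext fun x => ?_⟩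
    rw [← hΨ]
    exact eqOn_multiplierPredual (F := E.comp (precompDual m.fst)) (G := Ψ)
      (fun a f => (hEl' m a f).trans (hm a f).1) (fun a f => (hEr' m a f).trans (hm a f).2) _
      (hJmem x)
  let Φ := ContinuousLinearEquiv.ofBijective (multiplierPairing J E) hinj hsurj
  -- Weak* continuity of `T` follows once evaluation at each predual vector, composed with `T`, is
  -- again evaluation at a predual vector.
  have hcont : ∀ (T : DoubleCentralizer ℂ A → DoubleCentralizer ℂ A),
      (∀ x ∈ multiplierPredual A, ∃ y ∈ multiplierPredual A, ∀ m : DoubleCentralizer ℂ A,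
        E (x.comp (T m).fst) = E (y.comp m.fst)) →
      Continuous[weakStarTopology Φ, weakStarTopology Φ] T := by
    intro T hT
    refine continuous_induced_rng.2 ?_
    refine @continuous_toWeakDual _ (weakStarTopology Φ) _ _ _ _ fun x => ?_
    obtain ⟨y, hy, hxy⟩ := hT _ (hJmem x)
    obtain ⟨y, rfl⟩ := hJ y hy
    convert continuous_weakStar_apply Φ y using 1
    exact funext hxy
  have hact : ∀ (T : DoubleCentralizer ℂ A → A),
      (∀ f : StrongDual ℂ A, ∃ y ∈ multiplierPredual A, ∀ m : DoubleCentralizer ℂ A,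
        f (T m) = E (y.comp m.fst)) →
      Continuous[weakStarTopology Φ, inferInstance] fun m => toWeakSpace ℂ A (T m) := by
    intro T hT
    refine @continuous_toWeakSpace _ (weakStarTopology Φ) _ _ _ _ fun f => ?_
    obtain ⟨y, hy, hfy⟩ := hT f
    obtain ⟨y, rfl⟩ := hJ y hy
    convert continuous_weakStar_apply Φ y using 1
    exact funext hfy
  refine ⟨hF, X, inferInstance, inferInstance, inferInstance, Φ, ?_, fun a =>
    ⟨hact _ fun f => ⟨_, dualLeftAction_mem_multiplierPredual a f, fun m => (hEl' m a f).symm⟩,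
      hact _ fun f => ⟨_, dualRightAction_mem_multiplierPredual a f, fun m => (hEr' m a f).symm⟩⟩⟩
  intro n
  refine ⟨hcont _ fun x hx => ⟨_, hF.comp_fst_mem n hx, fun m => rfl⟩,
    hcont _ fun x hx => ⟨_, hF.comp_snd_mem n hx, fun m => ?_⟩⟩
  -- For `m ↦ m * n` the new vector is `x ∘ n.snd`. Unlike for `n * m`, the functionals inside `E`
  -- differ; only their values under `E` agree, which is checked on generators.
  refine eqOn_multiplierPredual (F := E.comp (precompDual (m * n).fst))
    (G := E.comp ((precompDual m.fst).comp (precompDual n.snd))) ?_ ?_ x hx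
  · intro a f
    refine (hEl' (m * n) a f).trans ?_
    simp only [ContinuousLinearMap.comp_apply, precompDual_apply, dualLeftAction_comp_snd, hEl']
    rfl
  · intro a f
    refine (hEr' (m * n) a f).trans ?_
    simp only [ContinuousLinearMap.comp_apply, precompDual_apply, hF.dualRightAction_comp_snd,
      hEr']
    rfl

end Predual

section BiadjointCriterion

variable {A : Type u} [NonUnitalNormedRing A] [NormedSpace ℂ A] [IsScalarTower ℂ A A]
  [SMulCommClass ℂ A A]

theorem isIdealInBidual_of_mem_biadjointIntoSelf [CompleteSpace A]
    (hl : ∀ (a : A) Ψ, ContinuousLinearMap.mul ℂ A a ∈ biadjointIntoSelf A Ψ)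
    (hr : ∀ (a : A) Ψ, (ContinuousLinearMap.mul ℂ A).flip a ∈ biadjointIntoSelf A Ψ) :
    IsIdealInBidual A :=
  isIdealInBidual_iff.2 fun a Ψ => ⟨hl a Ψ, hr a Ψ⟩

end BiadjointCriterion

/-! ### Continuous functions vanishing at infinity -/

namespace ZeroAtInftyContinuousMap

open Filter

variable {K : Type v} [TopologicalSpace K]

theorem norm_le_of_forall {f : ZeroAtInftyContinuousMap K ℂ} {C : ℝ} (hC : 0 ≤ C)
    (h : ∀ x, ‖f x‖ ≤ C) : ‖f‖ ≤ C :=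
  (BoundedContinuousFunction.norm_le hC).2 h

theorem norm_apply_le (f : ZeroAtInftyContinuousMap K ℂ) (x : K) : ‖f x‖ ≤ ‖f‖ :=
  f.toBCF.norm_coe_le_norm x

/-- Evaluation at a point, as a bounded functional. -/
noncomputable def evalDual (x : K) : StrongDual ℂ (ZeroAtInftyContinuousMap K ℂ) :=
  LinearMap.mkContinuous
    { toFun := fun f => f x
      map_add' := fun _ _ => rfl
      map_smul' := fun _ _ => rfl } 1 (fun f => by simpa using! norm_apply_le f x)

@[simp] theorem evalDual_apply (x : K) (f : ZeroAtInftyContinuousMap K ℂ) :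
    evalDual x f = f x := rfl

/-- Urysohn's lemma for `{x}` and a finite closed set; along growing `s` these functions converge
pointwise to the indicator of `x`. -/
theorem exists_bump [LocallyCompactSpace K] [T2Space K] (x : K) (s : Finset K) :
    ∃ f : ZeroAtInftyContinuousMap K ℂ, ‖f‖ ≤ 1 ∧ f x = 1 ∧ ∀ y ∈ s, y ≠ x → f y = 0 := by
  classical
  obtain ⟨f, h1, h0, hc, hI⟩ := exists_continuous_one_zero_of_isCompact
    (isCompact_singleton (x := x)) (s.erase x).finite_toSet.isClosed (by simp)
  have hc' : HasCompactSupport fun y => (f y : ℂ) := hc.comp_left Complex.ofReal_zero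
  refine ⟨⟨⟨fun y => (f y : ℂ), by fun_prop⟩, hc'.is_zero_at_infty⟩,
    norm_le_of_forall zero_le_one fun y => ?_, ?_, fun y hy hyx => ?_⟩
  · change ‖(f y : ℂ)‖ ≤ 1
    rw [Complex.norm_of_nonneg (hI y).1]
    exact (hI y).2
  · change (f x : ℂ) = 1
    rw [h1 (Set.mem_singleton x)]
    simp
  · change (f y : ℂ) = 0
    rw [h0 (by simp [hy, hyx])]
    simp

theorem discreteTopology_of_isIdealInBidual [LocallyCompactSpace K] [T2Space K]
    (h : IsIdealInBidual (ZeroAtInftyContinuousMap K ℂ)) : DiscreteTopology K := by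
  refine discreteTopology_iff_isOpen_singleton.2 fun x => ?_
  choose b hb1 hbx hb0 using exists_bump x
  have hU := Ultrafilter.of_le (atTop : Filter (Finset K))
  -- The fixed factor `b ∅` is there to apply weak compactness; all that matters is its value 1 at
  -- `x`.
  obtain ⟨g, hg⟩ := h.exists_weak_limit_mul (Ultrafilter.of (atTop : Filter (Finset K))) b 1 hb1
    (b ∅)
  have hgx : g x = 1 :=
    tendsto_nhds_unique (hg (evalDual x)) (by simp [hbx])
  have hgy : ∀ y, y ≠ x → g y = 0 := fun y hy => by
    refine tendsto_nhds_unique (hg (evalDual y)) (tendsto_const_nhds.congr' ?_)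
    refine hU ?_
    filter_upwards [eventually_ge_atTop ({y} : Finset K)] with s hs
    simp [hb0 s y (hs (by simp)) hy]
  have : ({x} : Set K) = g ⁻¹' {0}ᶜ := by
    ext y
    by_cases hy : y = x
    · simp [hy, hgx]
    · simp [hy, hgy y hy]
  rw [this]
  exact isOpen_compl_singleton.preimage g.continuous

/-! ### Discrete spaces: multiplications are limits of finite-rank operators -/

section Discrete

variable [DiscreteTopology K]

open Classical in
/-- The indicator function of a finite subset of a discrete space. -/
noncomputable def finsetIndicator (s : Finset K) : ZeroAtInftyContinuousMap K ℂ :=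
  ⟨⟨fun x => if x ∈ s then 1 else 0, continuous_of_discreteTopology⟩, by
    refine tendsto_const_nhds.congr' ?_
    rw [cocompact_eq_cofinite]
    filter_upwards [s.finite_toSet.compl_mem_cofinite] with x hx
    simp_all⟩

open Classical in
theorem finsetIndicator_apply (s : Finset K) (x : K) :
    finsetIndicator s x = if x ∈ s then 1 else 0 := rfl

theorem norm_finsetIndicator_le (s : Finset K) : ‖finsetIndicator s‖ ≤ 1 :=
  norm_le_of_forall zero_le_one fun x => by
    rw [finsetIndicator_apply]
    split_ifs <;> simp

theorem tendsto_finsetIndicator_mul (a : ZeroAtInftyContinuousMap K ℂ) :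
    Tendsto (fun s => finsetIndicator s * a) atTop (𝓝 a) := by
  rw [Metric.tendsto_nhds]
  intro ε hε
  have h := a.zero_at_infty'
  rw [cocompact_eq_cofinite, Metric.tendsto_nhds] at h
  have hfin : {x | ¬ dist (a x) 0 < ε / 2}.Finite := h (ε / 2) (half_pos hε)
  filter_upwards [eventually_ge_atTop hfin.toFinset] with s hs
  rw [dist_eq_norm]
  refine (norm_le_of_forall (half_pos hε).le fun x => ?_).trans_lt (half_lt_self hε)
  rw [sub_apply, mul_apply, finsetIndicator_apply]
  split_ifs with hx
  · simpa using (half_pos hε).le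
  · have : dist (a x) 0 < ε / 2 := by
      by_contra hc
      exact hx (hs (by simpa using hc))
    simpa using this.le

theorem mul_finsetIndicator_mul_eq_sum (s : Finset K) (a : ZeroAtInftyContinuousMap K ℂ) :
    ContinuousLinearMap.mul ℂ (ZeroAtInftyContinuousMap K ℂ) (finsetIndicator s * a) =
      ∑ x ∈ s, (evalDual x).smulRight (finsetIndicator {x} * a) := by
  classical
  ext b y
  rw [← evalDual_apply y, ← evalDual_apply y, sum_apply, map_sum]
  simp [finsetIndicator_apply, mul_comm]

theorem mul_mem_biadjointIntoSelf (a : ZeroAtInftyContinuousMap K ℂ)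
    (Ψ : StrongDual ℂ (StrongDual ℂ (ZeroAtInftyContinuousMap K ℂ))) :
    ContinuousLinearMap.mul ℂ (ZeroAtInftyContinuousMap K ℂ) a ∈ biadjointIntoSelf _ Ψ := by
  refine (isClosed_biadjointIntoSelf Ψ).mem_of_tendsto
    (((ContinuousLinearMap.mul ℂ (ZeroAtInftyContinuousMap K ℂ)).continuous.tendsto a).comp
      (tendsto_finsetIndicator_mul a)) (Eventually.of_forall fun s => ?_)
  rw [Function.comp_apply, mul_finsetIndicator_mul_eq_sum]
  exact Submodule.sum_mem _ fun x _ => smulRight_mem_biadjointIntoSelf Ψ _ _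

theorem isCompliant_of_discreteTopology : IsCompliant (ZeroAtInftyContinuousMap K ℂ) := by
  have hflip : (ContinuousLinearMap.mul ℂ (ZeroAtInftyContinuousMap K ℂ)).flip =
      ContinuousLinearMap.mul ℂ (ZeroAtInftyContinuousMap K ℂ) := by
    ext a b x
    simp
  refine (isIdealInBidual_of_mem_biadjointIntoSelf mul_mem_biadjointIntoSelf
    fun a Ψ => ?_).isCompliant atTop finsetIndicator 1 norm_finsetIndicator_le tendsto_finsetIndicator_mul fun a => ?_
  · rw [hflip]
    exact mul_mem_biadjointIntoSelf a Ψ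
  · convert tendsto_finsetIndicator_mul a using 2 with s
    ext x
    simp [mul_comm]

end Discrete

end ZeroAtInftyContinuousMap

/-! ### The group algebra of a noncompact group -/

namespace GroupAlgebraL1

open Filter

section Functionals

variable {G : Type u} [MeasurableSpace G] {μ : Measure G}

/-- The class of an integrable function. -/
noncomputable def ofIntegrable (f : G → ℂ) (hf : Integrable f μ) : GroupAlgebraL1 μ :=
  (hf.toL1 f : Lp ℂ 1 μ)

theorem ofIntegrable_ae (f : G → ℂ) (hf : Integrable f μ) :
    (ofIntegrable f hf).toFun =ᵐ[μ] f :=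
  hf.coeFn_toL1

theorem ext_ae {f g : GroupAlgebraL1 μ} (h : f.toFun =ᵐ[μ] g.toFun) : f = g :=
  Lp.ext h

theorem norm_setIntegral_le (s : Set G) (f : GroupAlgebraL1 μ) :
    ‖∫ x in s, f.toFun x ∂μ‖ ≤ ‖f‖ := by
  rw [norm_eq]
  exact (norm_integral_le_integral_norm _).trans (setIntegral_le_integral f.integrable_toFun.norm
    (Eventually.of_forall fun x => norm_nonneg _))

/-- Integration over a set, as a bounded functional on `L¹`. -/
noncomputable def setIntegralDual (μ : Measure G) (s : Set G) :
    StrongDual ℂ (GroupAlgebraL1 μ) :=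
  LinearMap.mkContinuous
    { toFun := fun f => ∫ x in s, f.toFun x ∂μ
      map_add' := fun f g => by
        rw [← integral_add f.integrable_toFun.restrict g.integrable_toFun.restrict]
        exact integral_congr_ae (ae_restrict_of_ae (add_ae f g))
      map_smul' := fun c f => by
        rw [RingHom.id_apply, smul_eq_mul, ← integral_const_mul]
        exact integral_congr_ae (ae_restrict_of_ae (smul_ae c f)) } 1
    (fun f => by simpa using! norm_setIntegral_le s f)

theorem setIntegralDual_apply (s : Set G) (f : GroupAlgebraL1 μ) :
    setIntegralDual μ s f = ∫ x in s, f.toFun x ∂μ := rfl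

theorem setIntegralDual_univ (f : GroupAlgebraL1 μ) :
    setIntegralDual μ Set.univ f = ∫ x, f.toFun x ∂μ := by
  rw [setIntegralDual_apply, setIntegral_univ]

/-- Integrable functions vanishing off a closed compact set are dense in `L¹`: inner regularity
handles indicators of sets of finite measure, and sums follow by taking unions. -/
theorem exists_isCompact_setIntegral_compl_le [TopologicalSpace G] [BorelSpace G] [R1Space G]
    [WeaklyLocallyCompactSpace G] [μ.Regular] (f : GroupAlgebraL1 μ) {ε : ℝ} (hε : 0 < ε) :
    ∃ K : Set G, IsCompact K ∧ IsClosed K ∧ ∫ x in Kᶜ, ‖f.toFun x‖ ∂μ ≤ ε := by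
  have key : ∃ g : G → ℂ, eLpNorm (f.toFun - g) 1 μ ≤ ENNReal.ofReal ε ∧
      AEStronglyMeasurable g μ ∧ ∃ K : Set G, IsCompact K ∧ IsClosed K ∧ ∀ x ∉ K, g x = 0 := by
    refine (memLp_one_iff_integrable.2 f.integrable_toFun).induction_dense ENNReal.one_ne_top
      (fun g => AEStronglyMeasurable g μ ∧
        ∃ K : Set G, IsCompact K ∧ IsClosed K ∧ ∀ x ∉ K, g x = 0) ?_ ?_ (fun g hg => hg.1)
      (ENNReal.ofReal_pos.2 hε).ne'
    · intro c s hs hμs δ hδ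
      obtain ⟨η, hη, hsmall⟩ := exists_eLpNorm_indicator_le (μ := μ) ENNReal.one_ne_top c hδ
      obtain ⟨K, hKs, hK, hKcl, hKη⟩ := hs.exists_isCompact_isClosed_sdiff_lt hμs.ne
        (ENNReal.coe_pos.2 hη).ne'
      refine ⟨K.indicator fun _ => c, ?_, (aestronglyMeasurable_const.indicator hKcl.measurableSet),
        K, hK, hKcl, fun x hx => Set.indicator_of_notMem hx _⟩
      rw [eLpNorm_sub_comm, ← Set.indicator_sdiff hKs]
      exact hsmall _ hKη.le
    · rintro g k ⟨hgm, K, hK, hKcl, hg⟩ ⟨hkm, L, hL, hLcl, hk⟩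
      refine ⟨hgm.add hkm, K ∪ L, hK.union hL, hKcl.union hLcl, fun x hx => ?_⟩
      rw [Set.mem_union, not_or] at hx
      simp [hg x hx.1, hk x hx.2]
  obtain ⟨g, hfg, hgm, K, hK, hKcl, hg⟩ := key
  have hgi : Integrable (f.toFun - g) μ := memLp_one_iff_integrable.1
    ⟨f.integrable_toFun.1.sub hgm, hfg.trans_lt ENNReal.ofReal_lt_top⟩
  refine ⟨K, hK, hKcl, ?_⟩
  have h1 : ∫ x in Kᶜ, ‖f.toFun x‖ ∂μ = ∫ x in Kᶜ, ‖(f.toFun - g) x‖ ∂μ :=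
    setIntegral_congr_fun hKcl.measurableSet.compl fun x hx => by simp [hg x hx]
  rw [h1]
  refine (setIntegral_le_integral hgi.norm
    (Eventually.of_forall fun x => norm_nonneg _)).trans ?_
  rw [integral_norm_eq_lintegral_enorm hgi.1, ← eLpNorm_one_eq_lintegral_enorm]
  exact ENNReal.toReal_le_of_le_ofReal hε.le hfg

end Functionals

section Translates

variable {G : Type u} [MeasurableSpace G] [Group G] [TopologicalSpace G] [IsTopologicalGroup G]
  [BorelSpace G] {μ : Measure G} [μ.IsHaarMeasure]

theorem integral_translate (y : G) (f : GroupAlgebraL1 μ) :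
    ∫ x, (translate μ y f).toFun x ∂μ = ∫ x, f.toFun x ∂μ := by
  rw [integral_congr_ae (translate_ae μ y f)]
  exact integral_mul_left_eq_self f.toFun y⁻¹

/-- Translation by `y` carries the part of `f` living on `L` off `K`, so only the rest of `f`
contributes. -/
theorem norm_setIntegral_translate_le {K L : Set G} (hK : MeasurableSet K) (hL : MeasurableSet L)
    {y : G} (hy : ∀ x ∈ L, y * x ∉ K) (f : GroupAlgebraL1 μ) :
    ‖∫ x in K, (translate μ y f).toFun x ∂μ‖ ≤ ∫ x in Lᶜ, ‖f.toFun x‖ ∂μ := by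
  rw [integral_congr_ae (ae_restrict_of_ae (translate_ae μ y f)), ← integral_indicator hK,
    ← integral_mul_left_eq_self _ y, ← integral_indicator hL.compl]
  refine norm_integral_le_of_norm_le (f.integrable_toFun.norm.indicator hL.compl)
    (Eventually.of_forall fun x => ?_)
  by_cases hx : x ∈ L
  · simp [hy x hx, hx]
  · by_cases hxK : y * x ∈ K <;> simp [hx, hxK]

variable [LocallyCompactSpace G] [μ.Regular]

theorem translate_mul (y : G) (f g : GroupAlgebraL1 μ) :
    translate μ y f * g = translate μ y (f * g) := by
  rw [mul_def, mul_def, ← (translate μ y).integral_comp_comm (integrable_mul f g)]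
  simp only [map_smul, translate_translate]
  rw [← integral_mul_left_eq_self (fun z => (translate μ y f).toFun z • translate μ z g) y]
  refine integral_congr_ae ?_
  have h := (measurePreserving_mul_left μ y).quasiMeasurePreserving.ae_eq_comp (translate_ae μ y f)
  filter_upwards [h] with z hz
  simp only [Function.comp_apply, inv_mul_cancel_left] at hz
  rw [hz]

theorem integral_mul (f g : GroupAlgebraL1 μ) :
    ∫ x, (f * g).toFun x ∂μ = (∫ x, f.toFun x ∂μ) * ∫ x, g.toFun x ∂μ := by
  have h := integral_mul_smul f g (φ := fun _ => (1 : ℂ)) continuous_const 1 (by simp)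
  simp only [smul_eq_mul, mul_one] at h
  rw [h, integral_mul_const]

theorem exists_integral_ne_zero [T2Space G] :
    ∃ f : GroupAlgebraL1 μ, ∫ x, f.toFun x ∂μ ≠ 0 := by
  let K : TopologicalSpace.PositiveCompacts G := Classical.arbitrary _
  have hK : MeasurableSet (K : Set G) := K.isCompact.isClosed.measurableSet
  have hKt : μ K ≠ ⊤ := K.isCompact.measure_lt_top.ne
  refine ⟨ofIntegrable ((K : Set G).indicator fun _ => 1)
    ((integrable_indicator_iff hK).2 (integrableOn_const hKt)), ?_⟩
  rw [integral_congr_ae (ofIntegrable_ae _ _), integral_indicator hK]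
  have hpos : μ K ≠ 0 := (Measure.measure_pos_of_nonempty_interior μ K.interior_nonempty).ne'
  simp [Measure.real, ENNReal.toReal_eq_zero_iff, hpos, hKt]

theorem compactSpace_of_isIdealInBidual [T2Space G] (h : IsIdealInBidual (GroupAlgebraL1 μ)) :
    CompactSpace G := by
  by_contra hG
  rw [not_compactSpace_iff] at hG
  obtain ⟨e, he⟩ := exists_integral_ne_zero (μ := μ)
  have hU := Ultrafilter.of_le (cocompact G)
  -- `(L_y e) * e = L_y (e * e)`, so `g` is a weak limit of translates of `e * e` as `y` tends to
  -- infinity.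
  obtain ⟨g, hg⟩ := h.exists_weak_limit_mul (Ultrafilter.of (cocompact G))
    (fun y => translate μ y e) ‖e‖ (fun y => (norm_translate μ y e).le) e
  simp only [translate_mul] at hg
  set c : ℂ := ∫ x, (e * e).toFun x ∂μ with hc
  have hc0 : 0 < ‖c‖ := norm_pos_iff.2 (by rw [hc, integral_mul]; exact mul_ne_zero he he)
  have hgc : ∫ x, g.toFun x ∂μ = c := by
    rw [← setIntegralDual_univ]
    refine tendsto_nhds_unique (hg _) ?_
    simp only [setIntegralDual_univ, integral_translate]
    exact tendsto_const_nhds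
  -- `g` has at most `‖c‖ / 3` of its mass off `K`, and its integral over `K` is at most `‖c‖ / 3`
  -- because `y L` misses `K` for `y` outside `K L⁻¹`. Its integral `c` would then have norm at most
  -- `2‖c‖ / 3`.
  obtain ⟨K, hKc, hKcl, hK⟩ := exists_isCompact_setIntegral_compl_le g (ε := ‖c‖ / 3) (by positivity)
  obtain ⟨L, hLc, hLcl, hL⟩ :=
    exists_isCompact_setIntegral_compl_le (e * e) (ε := ‖c‖ / 3) (by positivity)
  have hgK : ‖∫ x in K, g.toFun x ∂μ‖ ≤ ‖c‖ / 3 := by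
    refine le_of_tendsto (hg (setIntegralDual μ K)).norm (hU ?_)
    filter_upwards [(hKc.mul hLc.inv).compl_mem_cocompact] with y hy
    refine (norm_setIntegral_translate_le hKcl.measurableSet hLcl.measurableSet
      (fun x hx hyx => hy ?_) (e * e)).trans hL
    exact ⟨y * x, hyx, x⁻¹, by simpa using hx, by simp⟩
  have hsplit := integral_add_compl hKcl.measurableSet g.integrable_toFun
  have : ‖c‖ ≤ ‖c‖ / 3 + ‖c‖ / 3 := by
    conv_lhs => rw [← hgc, ← hsplit]
    exact (norm_add_le _ _).trans (add_le_add hgK ((norm_integral_le_integral_norm _).trans hK))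
  linarith

end Translates

end GroupAlgebraL1

/-! ### The group algebra of a compact group -/

section Conjugation

/-- `(S T R)'' Ψ = S'' (T'' (R'' Ψ))`, and `S''` extends `S`. With `S` and `R` both inversion, this
passes from right to left multiplications. -/
theorem comp_comp_mem_biadjointIntoSelf {E : Type v} [NormedAddCommGroup E] [NormedSpace ℂ E]
    [CompleteSpace E] {T : E →L[ℂ] E} (hT : ∀ Ψ, T ∈ biadjointIntoSelf E Ψ) (S R : E →L[ℂ] E)
    (Ψ : StrongDual ℂ (StrongDual ℂ E)) : S.comp (T.comp R) ∈ biadjointIntoSelf E Ψ := by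
  obtain ⟨g, hg⟩ := hT (Ψ.comp ((ContinuousLinearMap.compL ℂ E E ℂ).flip R))
  exact ⟨S g, fun f => hg (f.comp S)⟩

end Conjugation

/-! ### Unimodularity of compact groups -/

section Unimodular

variable {G : Type u} [MeasurableSpace G] [Group G] [TopologicalSpace G] [IsTopologicalGroup G]
  [CompactSpace G] [BorelSpace G]

theorem eq_of_isMulLeftInvariant_of_measure_univ_eq (ν μ : Measure G) [μ.IsHaarMeasure]
    [ν.IsMulLeftInvariant] [IsFiniteMeasureOnCompacts ν] (h : ν Set.univ = μ Set.univ) :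
    ν = μ := by
  have hν := Measure.isMulInvariant_eq_smul_of_compactSpace ν μ
  have h1 : (Measure.haarScalarFactor ν μ : ENNReal) * μ Set.univ = 1 * μ Set.univ :=
    (congrArg (fun m : Measure G => m Set.univ) hν).symm.trans (h.trans (one_mul _).symm)
  have hc := (ENNReal.mul_left_inj (NeZero.ne (μ Set.univ)) (measure_ne_top μ _)).1 h1
  rw [hν, ENNReal.coe_eq_one.1 hc, one_smul]

/-- A Haar measure on a compact group is invariant under inversion. -/
theorem isInvInvariant_of_compactSpace (μ : Measure G) [μ.IsHaarMeasure] : μ.IsInvInvariant := by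
  -- Right translates of `μ` are left invariant with the same mass, hence equal `μ`. Right
  -- invariance in turn makes the inverse measure left invariant, and the same uniqueness applies.
  have hr : μ.IsMulRightInvariant := ⟨fun g =>
    eq_of_isMulLeftInvariant_of_measure_univ_eq _ μ (by
      rw [Measure.map_apply (measurable_mul_const g) MeasurableSet.univ, Set.preimage_univ])⟩
  exact ⟨eq_of_isMulLeftInvariant_of_measure_univ_eq _ μ (by
    rw [Measure.inv_apply, Set.inv_univ])⟩

end Unimodular

namespace GroupAlgebraL1

open Filter

section Inversion

variable {G : Type u} [MeasurableSpace G] [Group G] [TopologicalSpace G] [IsTopologicalGroup G]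
  [BorelSpace G] (μ : Measure G) [μ.IsInvInvariant]

/-- The isometry `f ↦ (x ↦ f (x⁻¹))` of `L¹` for an inversion invariant measure. -/
noncomputable def inversion : GroupAlgebraL1 μ →L[ℂ] GroupAlgebraL1 μ :=
  (Lp.compMeasurePreservingₗᵢ (E := ℂ) (p := 1) ℂ (fun x : G => x⁻¹)
    (Measure.measurePreserving_inv μ)).toContinuousLinearMap

theorem inversion_ae (f : GroupAlgebraL1 μ) :
    (inversion μ f).toFun =ᵐ[μ] fun x => f.toFun x⁻¹ :=
  Lp.coeFn_compMeasurePreserving (show Lp ℂ 1 μ from f) (Measure.measurePreserving_inv μ)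

theorem inversion_inversion (f : GroupAlgebraL1 μ) : inversion μ (inversion μ f) = f := by
  refine ext_ae ((inversion_ae μ _).trans ?_)
  have h := (Measure.measurePreserving_inv μ).quasiMeasurePreserving.ae_eq_comp (inversion_ae μ f)
  exact h.trans (Eventually.of_forall fun x => by simp)

end Inversion

section Compact

variable {G : Type u} [MeasurableSpace G] [Group G] [TopologicalSpace G] [IsTopologicalGroup G]
  [CompactSpace G] [BorelSpace G] (μ : Measure G) [μ.IsHaarMeasure]

/-- The inclusion of the continuous functions into `L¹` of a compact group. -/
noncomputable def ofContinuous : C(G, ℂ) →L[ℂ] GroupAlgebraL1 μ :=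
  (ContinuousMap.toLp 1 μ ℂ : C(G, ℂ) →L[ℂ] Lp ℂ 1 μ)

theorem ofContinuous_ae (a : C(G, ℂ)) : (ofContinuous μ a).toFun =ᵐ[μ] a :=
  ContinuousMap.coeFn_toLp (𝕜 := ℂ) μ a

theorem denseRange_ofContinuous [T2Space G] : DenseRange (ofContinuous μ) :=
  ContinuousMap.toLp_denseRange ℂ μ ℂ ENNReal.one_ne_top

/-- The left translates of a continuous function, as a continuous family. -/
noncomputable def translates (b : C(G, ℂ)) : C(G, C(G, ℂ)) :=
  (ContinuousMap.mk (fun p : G × G => b (p.1⁻¹ * p.2)) (by fun_prop)).curry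

@[simp] theorem translates_apply (b : C(G, ℂ)) (y x : G) : translates b y x = b (y⁻¹ * x) := rfl

theorem translate_ofContinuous (b : C(G, ℂ)) (y : G) :
    translate μ y (ofContinuous μ b) = ofContinuous μ (translates b y) := by
  refine ext_ae ((translate_ae μ y _).trans (Filter.EventuallyEq.trans ?_
    (ofContinuous_ae μ _).symm))
  exact (measurePreserving_mul_left μ y⁻¹).quasiMeasurePreserving.ae_eq_comp (ofContinuous_ae μ b)

theorem inversion_ofContinuous [μ.IsInvInvariant] (b : C(G, ℂ)) :
    inversion μ (ofContinuous μ b) =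
      ofContinuous μ (b.comp (ContinuousMap.mk (fun x : G => x⁻¹) (by fun_prop))) := by
  refine ext_ae ((inversion_ae μ _).trans (Filter.EventuallyEq.trans ?_
    (ofContinuous_ae μ _).symm))
  exact (Measure.measurePreserving_inv μ).quasiMeasurePreserving.ae_eq_comp (ofContinuous_ae μ b)

/-- The convolution of two continuous functions is a continuous function. -/
theorem exists_ofContinuous_mul (a b : C(G, ℂ)) : ∃ c : C(G, ℂ),
    ofContinuous μ a * ofContinuous μ b = ofContinuous μ c ∧
      ∀ t, c t = ∫ y, a y * b (y⁻¹ * t) ∂μ := by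
  -- The convolution integral is formed in `C(G, ℂ)`, from which it can both be mapped to `L¹` and
  -- be evaluated at points.
  have hint : Integrable (fun y => (ofContinuous μ a).toFun y • translates b y) μ :=
    (ofContinuous μ a).integrable_smul_of_continuous (translates b).continuous ‖translates b‖
      fun y => (translates b).norm_coe_le_norm y
  refine ⟨∫ y, (ofContinuous μ a).toFun y • translates b y ∂μ, ?_, fun t => ?_⟩
  · rw [mul_def, ← (ofContinuous μ).integral_comp_comm hint]
    simp only [map_smul, translate_ofContinuous]
  · have := (ContinuousMap.evalCLM ℂ t).integral_comp_comm hint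
    refine this.symm.trans (integral_congr_ae ?_)
    filter_upwards [ofContinuous_ae μ a] with y hy
    simp [hy]

theorem inversion_mul [T2Space G] [μ.IsInvInvariant] (f g : GroupAlgebraL1 μ) :
    inversion μ (f * g) = inversion μ g * inversion μ f := by
  refine (denseRange_ofContinuous μ).induction_on₂
    (p := fun f g => inversion μ (f * g) = inversion μ g * inversion μ f)
    (isClosed_eq (by fun_prop) (by fun_prop)) (fun a b => ?_) f g
  obtain ⟨c, hc, hct⟩ := exists_ofContinuous_mul μ a b
  obtain ⟨d, hd, hdt⟩ := exists_ofContinuous_mul μ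
    (b.comp (ContinuousMap.mk (fun x : G => x⁻¹) (by fun_prop)))
    (a.comp (ContinuousMap.mk (fun x : G => x⁻¹) (by fun_prop)))
  simp only [inversion_ofContinuous, hc, hd]
  congr 1
  ext t
  simp only [ContinuousMap.comp_apply, ContinuousMap.coe_mk, hct, hdt]
  -- Substituting `t y` for `y` turns the integrand into `b (y⁻¹ t⁻¹) a (y)`.
  rw [← integral_mul_left_eq_self (fun y => b y⁻¹ * a (y⁻¹ * t)⁻¹) t]
  refine integral_congr_ae (Eventually.of_forall fun y => ?_)
  simp [mul_comm]

end Compact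

/-! ### A bounded approximate identity fixed by inversion -/

section ApproximateIdentity

variable {G : Type u} [MeasurableSpace G] [Group G] [TopologicalSpace G] [IsTopologicalGroup G]
  [CompactSpace G] [BorelSpace G] (μ : Measure G) [μ.IsHaarMeasure]

theorem integrable_indicator_interior_inter_inv (V : Set G) : Integrable
    ((interior V ∩ (interior V)⁻¹).indicator
      fun _ => ((μ.real (interior V ∩ (interior V)⁻¹))⁻¹ : ℂ)) μ :=
  (integrable_const _).indicator (isOpen_interior.inter isOpen_interior.inv).measurableSet

/-- The normalised indicator function of a symmetric open subset of `V`. -/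
noncomputable def bump (V : Set G) : GroupAlgebraL1 μ :=
  ofIntegrable _ (integrable_indicator_interior_inter_inv μ V)

theorem bump_ae (V : Set G) : (bump μ V).toFun =ᵐ[μ] (interior V ∩ (interior V)⁻¹).indicator
    fun _ => ((μ.real (interior V ∩ (interior V)⁻¹))⁻¹ : ℂ) :=
  ofIntegrable_ae _ _

theorem norm_bump_le (V : Set G) : ‖bump μ V‖ ≤ 1 := by
  have h : (fun x => ‖(bump μ V).toFun x‖) =ᵐ[μ] (interior V ∩ (interior V)⁻¹).indicator
      fun _ => ‖((μ.real (interior V ∩ (interior V)⁻¹))⁻¹ : ℂ)‖ := by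
    filter_upwards [bump_ae μ V] with x hx
    rw [hx, norm_indicator_eq_indicator_norm]
  rw [norm_eq, integral_congr_ae h]
  rw [integral_indicator (isOpen_interior.inter isOpen_interior.inv).measurableSet]
  simp only [integral_const, smul_eq_mul, measureReal_restrict_apply_univ]
  simp only [norm_inv, Complex.norm_real, Real.norm_eq_abs, abs_of_nonneg measureReal_nonneg]
  -- This also covers a null set, where the inverse of 0 is 0 and the bump vanishes.
  exact mul_inv_le_one

theorem integral_bump {V : Set G} (hV : V ∈ 𝓝 1) : ∫ x, (bump μ V).toFun x ∂μ = 1 := by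
  have hW : IsOpen (interior V ∩ (interior V)⁻¹) := isOpen_interior.inter isOpen_interior.inv
  have hpos : μ.real (interior V ∩ (interior V)⁻¹) ≠ 0 := by
    refine (ENNReal.toReal_pos (hW.measure_pos μ ⟨1, ?_⟩).ne' (measure_ne_top _ _)).ne'
    have := mem_interior_iff_mem_nhds.2 hV
    exact ⟨this, by simpa using this⟩
  rw [integral_congr_ae (bump_ae μ V), integral_indicator hW.measurableSet]
  simp [hpos]

theorem inversion_bump [μ.IsInvInvariant] (V : Set G) : inversion μ (bump μ V) = bump μ V := by
  refine ext_ae ((inversion_ae μ _).trans (Filter.EventuallyEq.trans ?_ (bump_ae μ V).symm))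
  refine ((Measure.measurePreserving_inv μ).quasiMeasurePreserving.ae_eq_comp
    (bump_ae μ V)).trans (Eventually.of_forall fun x => ?_)
  have h : x⁻¹ ∈ interior V ∩ (interior V)⁻¹ ↔ x ∈ interior V ∩ (interior V)⁻¹ := by
    simp [and_comm]
  by_cases hx : x ∈ interior V ∩ (interior V)⁻¹
  · simp only [Function.comp_apply, Set.indicator_of_mem hx, Set.indicator_of_mem (h.2 hx)]
  · simp only [Function.comp_apply, Set.indicator_of_notMem hx,
      Set.indicator_of_notMem (mt h.1 hx)]

/-- The bump has integral 1, so the difference is the average of `L_y a - a` over points `y` of `V`.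
-/
theorem norm_bump_mul_sub_le {V : Set G} (hV : V ∈ 𝓝 1) (a : GroupAlgebraL1 μ) {ε : ℝ}
    (hε : 0 ≤ ε) (h : ∀ y ∈ V, ‖translate μ y a - a‖ ≤ ε) : ‖bump μ V * a - a‖ ≤ ε := by
  have h1 : a = ∫ y, (bump μ V).toFun y • a ∂μ := by
    rw [integral_smul_const, integral_bump μ hV, one_smul]
  have h2 : bump μ V * a - a = ∫ y, (bump μ V).toFun y • (translate μ y a - a) ∂μ := by
    conv_lhs => enter [2]; rw [h1]
    rw [mul_def, ← integral_sub (integrable_mul _ _) ((bump μ V).integrable_toFun.smul_const a)]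
    simp only [smul_sub]
  have h3 : ‖bump μ V * a - a‖ ≤ ∫ y, ‖(bump μ V).toFun y‖ * ε ∂μ := by
    rw [h2]
    refine norm_integral_le_of_norm_le ((bump μ V).integrable_toFun.norm.mul_const ε) ?_
    filter_upwards [bump_ae μ V] with y hy
    rw [norm_smul]
    by_cases hyW : y ∈ interior V ∩ (interior V)⁻¹
    · exact mul_le_mul_of_nonneg_left (h y (interior_subset hyW.1)) (norm_nonneg _)
    · rw [hy, Set.indicator_of_notMem hyW]
      simp
  rw [integral_mul_const, ← norm_eq] at h3
  exact h3.trans (mul_le_of_le_one_left hε (norm_bump_le μ V))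

/-- The principal filter discards small sets that are not neighbourhoods of 1, for which the bump
need not have integral 1. -/
theorem tendsto_bump_mul (a : GroupAlgebraL1 μ) :
    Tendsto (fun V => bump μ V * a) ((𝓝 (1 : G)).smallSets ⊓ 𝓟 {V | V ∈ 𝓝 1}) (𝓝 a) := by
  rw [Metric.tendsto_nhds]
  intro ε hε
  have hcont : Tendsto (fun y => ‖translate μ y a - a‖) (𝓝 1) (𝓝 0) := by
    have h1 : translate μ 1 a = a := by
      have h := translate_ae μ 1 a
      simp only [inv_one, one_mul] at h
      exact ext_ae h
    have h2 := (((continuous_translate μ a).sub continuous_const).norm (E := GroupAlgebraL1 μ)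
      (f := fun y => translate μ y a - a)).tendsto 1
    simpa [h1] using h2
  have hev := eventually_smallSets_forall.2 (hcont.eventually (gt_mem_nhds (half_pos hε)))
  filter_upwards [mem_inf_of_left hev, mem_inf_of_right (mem_principal_self _)] with V hV hV1
  rw [dist_eq_norm]
  exact (norm_bump_mul_sub_le μ hV1 a (half_pos hε).le fun y hy => (hV y hy).le).trans_lt
    (half_lt_self hε)

/-- Inversion reverses products and fixes the bumps, so it carries the left-hand limit to the
right-hand one. -/
theorem tendsto_mul_bump [T2Space G] [μ.IsInvInvariant] (a : GroupAlgebraL1 μ) :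
    Tendsto (fun V => a * bump μ V) ((𝓝 (1 : G)).smallSets ⊓ 𝓟 {V | V ∈ 𝓝 1}) (𝓝 a) := by
  have h := ((inversion μ).continuous.tendsto _).comp (tendsto_bump_mul μ (inversion μ a))
  simpa only [Function.comp_def, inversion_mul, inversion_bump, inversion_inversion] using h

end ApproximateIdentity

/-! ### Convolution operators on compact groups -/

section WeakCompactness

variable {G : Type u} [MeasurableSpace G] [Group G] [TopologicalSpace G] [IsTopologicalGroup G]
  [CompactSpace G] [BorelSpace G] {μ : Measure G} [μ.IsHaarMeasure]

/-- `E` is cut into pieces on which `F` is within `ε` of its value at a centre; freezing `F` there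
gives a finite-rank operator. The induction peels off one centre at a time, and the error is kept as
an integral over `E` so that the pieces add up. -/
theorem exists_biadjointIntoSelf_approx {F : G → GroupAlgebraL1 μ} (hF : Continuous F)
    (hFi : ∀ b : GroupAlgebraL1 μ, Integrable (fun y => b.toFun y • F y) μ) {ε : ℝ}
    (Ψ : StrongDual ℂ (StrongDual ℂ (GroupAlgebraL1 μ))) (t : Finset G) (E : Set G)
    (hE : MeasurableSet E) (hcov : ∀ y ∈ E, ∃ c ∈ t, ‖F y - F c‖ < ε) :
    ∃ T ∈ biadjointIntoSelf (GroupAlgebraL1 μ) Ψ, ∀ b : GroupAlgebraL1 μ,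
      ‖∫ y in E, b.toFun y • F y ∂μ - T b‖ ≤ ∫ y in E, ‖b.toFun y‖ * ε ∂μ := by
  classical
  induction t using Finset.induction_on generalizing E with
  | empty =>
    have hE0 : E = ∅ := Set.eq_empty_of_forall_notMem fun y hy => by simpa using hcov y hy
    exact ⟨0, Submodule.zero_mem _, fun b => by simp [hE0]⟩
  | insert c t _ ih =>
    let U : Set G := {y | ‖F y - F c‖ < ε}
    have hU : MeasurableSet U :=
      (isOpen_lt (hF.sub continuous_const).norm continuous_const).measurableSet
    obtain ⟨T, hT, hTb⟩ := ih (E \ U) (hE.diff hU) fun y hy => by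
      obtain ⟨d, hd, hyd⟩ := hcov y hy.1
      rcases Finset.mem_insert.1 hd with rfl | hd
      · exact absurd hyd hy.2
      · exact ⟨d, hd, hyd⟩
    refine ⟨(setIntegralDual μ (E ∩ U)).smulRight (F c) + T,
      Submodule.add_mem _ (smulRight_mem_biadjointIntoSelf Ψ _ _) hT, fun b => ?_⟩
    have h1 : ‖∫ y in E ∩ U, b.toFun y • F y ∂μ - setIntegralDual μ (E ∩ U) b • F c‖ ≤
        ∫ y in E ∩ U, ‖b.toFun y‖ * ε ∂μ := by
      rw [setIntegralDual_apply, ← integral_smul_const,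
        ← integral_sub (hFi b).restrict (b.integrable_toFun.restrict.smul_const _)]
      refine norm_integral_le_of_norm_le (b.integrable_toFun.norm.mul_const ε).restrict ?_
      filter_upwards [ae_restrict_mem (hE.inter hU)] with y hy
      rw [← smul_sub, norm_smul]
      exact mul_le_mul_of_nonneg_left hy.2.le (norm_nonneg _)
    rw [← integral_inter_add_sdiff hU (hFi b).integrableOn,
      ← integral_inter_add_sdiff hU (b.integrable_toFun.norm.mul_const ε).integrableOn,
      add_apply, ContinuousLinearMap.smulRight_apply, add_sub_add_comm]
    exact (norm_add_le _ _).trans (add_le_add h1 (hTb b))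

/-- `b * a` is the integral of `b(y) L_y a`, and by compactness of `G` finitely many balls of radius
`ε / 2` cover the orbit of `a`. -/
theorem flip_mul_mem_biadjointIntoSelf (a : GroupAlgebraL1 μ)
    (Ψ : StrongDual ℂ (StrongDual ℂ (GroupAlgebraL1 μ))) :
    (ContinuousLinearMap.mul ℂ (GroupAlgebraL1 μ)).flip a ∈ biadjointIntoSelf _ Ψ := by
  refine (isClosed_biadjointIntoSelf Ψ).closure_subset (Metric.mem_closure_iff.2 fun ε hε => ?_)
  have hF := continuous_translate μ a
  obtain ⟨t, -, ht⟩ := isCompact_univ.elim_nhds_subcover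
    (fun c => {y | ‖translate μ y a - translate μ c a‖ < ε / 2}) fun c _ =>
      (isOpen_lt (hF.sub continuous_const).norm continuous_const).mem_nhds (by simpa using hε)
  obtain ⟨T, hT, hTb⟩ := exists_biadjointIntoSelf_approx hF (fun b => integrable_mul b a) Ψ t
    Set.univ MeasurableSet.univ fun y hy => by simpa using ht hy
  refine ⟨T, hT, ?_⟩
  rw [dist_eq_norm]
  refine (ContinuousLinearMap.opNorm_le_bound _ (half_pos hε).le fun b => ?_).trans_lt
    (half_lt_self hε)
  have h := hTb b
  rw [setIntegral_univ, setIntegral_univ, integral_mul_const, ← norm_eq, ← mul_def] at h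
  exact h.trans_eq (mul_comm _ _)

theorem isCompliant_of_compactSpace [T2Space G] : IsCompliant (GroupAlgebraL1 μ) := by
  have := isInvInvariant_of_compactSpace μ
  have hl : ∀ (a : GroupAlgebraL1 μ) Ψ,
      ContinuousLinearMap.mul ℂ (GroupAlgebraL1 μ) a ∈ biadjointIntoSelf _ Ψ := fun a Ψ => by
    -- Left multiplication by `a` is right multiplication by its inversion, conjugated by inversion.
    convert comp_comp_mem_biadjointIntoSelf (flip_mul_mem_biadjointIntoSelf (inversion μ a))
      (inversion μ) (inversion μ) Ψ using 1
    ext b : 1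
    simp [inversion_mul, inversion_inversion]
  have hne : ((𝓝 (1 : G)).smallSets ⊓ 𝓟 {V | V ∈ 𝓝 1}).NeBot :=
    frequently_iff_neBot.1 (frequently_smallSets_mem _)
  exact (isIdealInBidual_of_mem_biadjointIntoSelf hl flip_mul_mem_biadjointIntoSelf).isCompliant
    _ (bump μ) 1 (norm_bump_le μ) (tendsto_bump_mul μ) (tendsto_mul_bump μ)

end WeakCompactness

end GroupAlgebraL1

theorem proposition2p0p8 :
    (∀ (A : Type u) [NonUnitalNormedRing A] [NormedSpace ℂ A] [IsScalarTower ℂ A A]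
        [SMulCommClass ℂ A A] [CompleteSpace A],
      IsCompliant A → IsIdealInBidual A) ∧
    (∀ (K : Type v) [TopologicalSpace K] [LocallyCompactSpace K] [T2Space K],
      IsCompliant (ZeroAtInftyContinuousMap K ℂ) ↔ DiscreteTopology K) ∧
    (∀ (G : Type w) [Group G] [TopologicalSpace G] [IsTopologicalGroup G] [LocallyCompactSpace G]
        [T2Space G] [MeasurableSpace G] [BorelSpace G] (μ : Measure G) [μ.IsHaarMeasure]
        [μ.Regular],
      IsCompliant (GroupAlgebraL1 μ) ↔ CompactSpace G) := by
  refine ⟨fun A _ _ _ _ _ h => h.isIdealInBidual, fun K _ _ _ => ⟨fun h => ?_, fun _ => ?_⟩,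
    fun G _ _ _ _ _ _ _ μ _ _ => ⟨fun h => ?_, fun _ => ?_⟩⟩
  · exact ZeroAtInftyContinuousMap.discreteTopology_of_isIdealInBidual h.isIdealInBidual
  · exact ZeroAtInftyContinuousMap.isCompliant_of_discreteTopology
  · exact GroupAlgebraL1.compactSpace_of_isIdealInBidual h.isIdealInBidual
  · exact GroupAlgebraL1.isCompliant_of_compactSpace
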